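/- **Setting.** There are $n\ge 1$ users; user $i$ holds an item $v_i\in[d]$, or no item ($v_i=\bot$). Let $f(v)=\frac1n\#\{i: v_i=v\}$, let $0<\varepsilon\le\ln 2$ and $0<\beta<1$ ($\log$ is the natural logarithm), and put $T=\lceil\log(3/\beta)\rceil$ and $\varepsilon'=\varepsilon/(2T+1)$. Let $K$ be an integer with $n^{3/2}\le K<2n^{3/2}$ ($n^{3/2}$ up to rounding). Fix a pairwise independent hash family $h_s:[d]\to[K]$ with uniform seed $s$ in a finite set, and a binary code $\mathrm{Enc}:[d]\to\{\pm1/\sqrt m\}^m$ of relative distance $\zeta\in(0,1/2)$, with a decoder $\mathrm{Dec}$ that corrects fewer than $\zeta m/2$ errors. *Basic randomizer* $\mathcal R(x,\varepsilon')$ for $x\in\{\pm1/\sqrt m\}^m\cup\{0\}$: draw $j\in[m]$ uniformly and output the vector whose only non-zero entry is $z_j=\pm c\sqrt m$ at position $j$, $c=\frac{e^{\varepsilon'}+1}{e^{\varepsilon'}-1}$, where the sign of $z_j$ is that of $x_j$ with probability $\frac{e^{\varepsilon'}}{e^{\varepsilon'}+1}$ if $x\ne 0$, and uniform if $x=0$.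 *Protocol Prot-SH.* Public coins: $T$ independent uniform seeds $s_1,\dots,s_T$ and a matrix $\Phi$ with $d$ columns $\Phi_v$ and i.i.d. uniform entries $\pm1/\sqrt{m'}$, where $m'=\log(d+1)\log(6/\beta)/\gamma^2$ with $\gamma=\sqrt{\log(6d/\beta)/(\varepsilon'^2n)}$, rounded up to a positive integer. User $i$ sends the report $Q_i(v_i)$, consisting of independent components: in each channel $(t,k)\in[T]\times[K]$, $\mathcal R(\mathrm{Enc}(v_i),\varepsilon')$ if $v_i\neq\bot$ and $h_{s_t}(v_i)=k$, and $\mathcal R(0,\varepsilon')$ otherwise; and in one further channel $\mathcal R(\Phi_{v_i},\varepsilon')$ (with $\Phi_\bot=0$). The server averages the received reports in each channel (an average over no reports is $0$), rounds each of the first $TK$ averages to the nearest vertex of the hypercube (sign $+$ for entries $\ge0$) and decodes it with $\mathrm{Dec}$, which gives a set of candidate items. It estimates $\hat f(v)=\langle\Phi_v,\bar z\rangle$, $\bar z$ being the average in the further channel, and outputs the list $\mathrm{List}$ of the candidates $v$ with $\hat f(v)\ge\theta:=\frac{2T+1}{\varepsilon}\sqrt{\frac{\log d\,\log(1/\beta)}{n}}$,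 together with their estimates. For $v\notin\mathrm{List}$ the estimate $\hat f(v)$ is understood to be $0$. *1-bit protocol.* The public coins contain in addition independent public strings $y_i$ drawn from $Q_i(\bot)$. User $i$ sends a single bit $b_i\sim\mathrm{Bernoulli}(p_i)$, $p_i=\frac12\frac{\Pr[Q_i(v_i)=y_i]}{\Pr[Q_i(\bot)=y_i]}$, where the probabilities are conditional on the seeds and $\Phi$. The server runs the server's part of Prot-SH on the collection of those $y_i$ with $b_i=1$ (the parameters $T,K,m',\theta$ are those for $n$; averages are over the collected strings). **Theorem.** 1. (Privacy.) For all values of the public coins and every user $i$, $p_i\le 1$ for all items in $[d]\cup\{\bot\}$, and the map from the user's item to the random bit $b_i$ is $\varepsilon$-differentially private: $\Pr[b_i\in A\mid v]\le e^{\varepsilon}\Pr[b_i\in A\mid v']$ for all $v,v'\in[d]\cup\{\bot\}$ and all $A\subseteq\{0,1\}$. 2. (Error.) For all $\zeta\in(0,1/2)$, $\rho>0$ and $\beta_0\in(0,1)$ there is a constant $C>0$ such that for all $n\ge1$, $d\ge2$, $0<\varepsilon\le\ln2$, $0<\beta\le\beta_0$, all $K$ and hash families as above, and all codes as above with $m\le\rho\log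 d$, the number $$e=C\,\frac{\log^{3/2}(1/\beta)}{\varepsilon}\sqrt{\frac{\log d}{n}}$$ satisfies $\theta\le e$ and, for all users' items, with probability at least $1-\beta$ the output of the 1-bit protocol satisfies - for every $t\ge\theta$, $\{v: f(v)\ge t+e\}\subseteq\{v\in\mathrm{List}:\hat f(v)\ge t\}\subseteq\{v: f(v)\ge t-e\}$; in particular (with $t=\theta$) $\mathrm{List}$ contains every item with $f(v)\ge\eta:=\theta+e=O\Big(\frac{\log^{3/2}(1/\beta)}{\varepsilon}\sqrt{\frac{\log d}{n}}\Big)$; - $\max_{v\in[d]}|\hat f(v)-f(v)|\le e$. -/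

import Mathlib

open scoped ENNReal NNReal

noncomputable section

namespace SuccinctHistogram

/-! ### Discrete probability -/

/-- The law of a family of independent random variables with laws `p i`. -/
def indep {ι : Type*} [Fintype ι] [DecidableEq ι] {α : ι → Type*} [∀ i, Fintype (α i)]
    (p : ∀ i, PMF (α i)) : PMF (∀ i, α i) :=
  PMF.ofFintype (fun f => ∏ i, p i (f i)) (by
    have h : ∀ i, ∑ a, p i a = 1 := fun i => by
      rw [← tsum_fintype (L := SummationFilter.unconditional _)]
      exact (p i).tsum_coe
    rw [← Fintype.prod_sum (fun i a => p i a)]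
    simp [h])

/-- A biased coin: `true` with probability `p` (truncated at `1`), and `false` otherwise. -/
def coin (p : ℝ≥0∞) : PMF Bool :=
  PMF.ofFintype (fun b => cond b (min p 1) (1 - min p 1)) (by simp)

/-- Pure `ε`-local differential privacy of a randomized algorithm `Q : V → Z`. -/
def IsLocallyPrivate {V Z : Type*} (ε : ℝ) (Q : V → PMF Z) : Prop :=
  ∀ (v v' : V) (A : Set Z),
    (Q v).toOuterMeasure A ≤ ENNReal.ofReal (Real.exp ε) * (Q v').toOuterMeasure A

/-! ### One-round local protocols and the 1-bit transformation -/

/-- A protocol with `n` users in the local model with public coins. Users hold an item of `V` or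
no item (`none`, written `⊥` on paper). The public coins `c` are drawn first and are seen by
everyone; user `i` sends a report drawn from `randomizer c i v`; the server computes its output
from the coins and the collection of reports that it has received. -/
structure LocalProtocol (n : ℕ) (V Coins Report Out : Type*) where
  coins : PMF Coins
  randomizer : Coins → Fin n → Option V → PMF Report
  server : Coins → Multiset Report → Out

namespace LocalProtocol

variable {n : ℕ} {V Coins Report Out : Type*}

/-- The probability with which user `i`, holding `v`, accepts the public string `y`:
`(1/2) Pr[Q_i(v) = y] / Pr[Q_i(⊥) = y]`. -/
def acceptProb (P : LocalProtocol n V Coins Report Out) (c : Coins) (i : Fin n) (y : Report)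
    (v : Option V) : ℝ≥0∞ :=
  (1 / 2) * (P.randomizer c i v y / P.randomizer c i none y)

/-- What user `i` sends in the 1-bit protocol, given the public coins `c` and its public
string `y`: a single bit, drawn from its own private coin. -/
def oneBitRandomizer (P : LocalProtocol n V Coins Report Out) (c : Coins) (i : Fin n)
    (y : Report) (v : Option V) : PMF Bool :=
  coin (P.acceptProb c i y v)

/-- The public strings `y_i` whose bit is `1`. -/
def collected (y : Fin n → Report) (b : Fin n → Bool) : Multiset Report :=
  (Finset.univ.filter fun i => b i = true).val.map y

/-- The law of the output of the 1-bit protocol on the users' items `v`: draw the public coins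
`c` of the original protocol and independent public strings `y_i` from `Q_i(⊥)`; every user sends
one bit; the server runs the original server algorithm on the collected strings. -/
def oneBitOutput [Fintype Report] (P : LocalProtocol n V Coins Report Out)
    (v : Fin n → Option V) : PMF Out :=
  P.coins.bind fun c =>
    (indep fun i => P.randomizer c i none).bind fun y =>
      (indep fun i => P.oneBitRandomizer c i (y i) (v i)).map fun b =>
        P.server c (collected y b)

end LocalProtocol

/-! ### The hypercube, codes and hashing -/

/-- The sign `±1` coded by a bit. -/
def sgn (b : Bool) : ℝ := if b then 1 else -1

/-- The vertex of the hypercube `{-1/√m, 1/√m}^m` coded by a string of bits. -/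
def vertex {m : ℕ} (x : Fin m → Bool) : Fin m → ℝ := fun j => sgn (x j) / Real.sqrt m

/-- A binary `(d, m, ζ)`-code, with a decoder that corrects fewer than `m ζ / 2` errors. The bit
strings stand for vertices of the hypercube, on which `‖x - x'‖ ≥ 2 √ζ` says that the Hamming
distance is at least `ζ m`. -/
structure BinaryCode (d : ℕ) (ζ : ℝ) where
  m : ℕ
  m_pos : 0 < m
  enc : Fin d → Fin m → Bool
  dec : (Fin m → Bool) → Fin d
  dist_le : ∀ v v', v ≠ v' → ζ * m ≤ (hammingDist (enc v) (enc v') : ℝ)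
  dec_eq : ∀ v y, (hammingDist y (enc v) : ℝ) < m * ζ / 2 → dec y = v

instance {d : ℕ} {ζ : ℝ} (code : BinaryCode d ζ) : NeZero code.m := ⟨code.m_pos.ne'⟩

/-- A pairwise independent family of hash functions `[d] → [K]` with a uniform seed in `S`. -/
structure PairwiseIndepHash (S : Type*) [Fintype S] (d K : ℕ) where
  hash : S → Fin d → Fin K
  pairwise_indep : ∀ v v', v ≠ v' → ∀ j k : Fin K,
    (((Finset.univ.filter fun s => hash s v = j ∧ hash s v' = k).card : ℝ)
      / Fintype.card S) = 1 / (K : ℝ) ^ 2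

/-! ### The basic randomizer -/

/-- `c_ε = (e^ε + 1) / (e^ε - 1)`. -/
def cEps (ε : ℝ) : ℝ := (Real.exp ε + 1) / (Real.exp ε - 1)

/-- The basic randomizer. The input is a vertex of the hypercube, or `none` for the zero vector.
The output is the pair of a uniform index `j` and the sign of the entry `z_j`, which is the sign
of `x_j` with probability `e^ε / (e^ε + 1)`, and uniform when the input is the zero vector. -/
def basicRandomizer {m : ℕ} [NeZero m] (ε : ℝ) (x : Option (Fin m → Bool)) :
    PMF (Fin m × Bool) :=
  (PMF.uniformOfFintype (Fin m)).bind fun j =>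
    match x with
    | some x => (coin (ENNReal.ofReal (Real.exp ε / (Real.exp ε + 1)))).map fun keep =>
        (j, if keep then x j else !(x j))
    | none => (PMF.uniformOfFintype Bool).map fun b => (j, b)

/-- The vector `(0, …, 0, z_j, 0, …, 0)`, `z_j = ± c_ε √m`, that a report `(j, sign)` stands
for. -/
def reportVec {m : ℕ} (ε : ℝ) (r : Fin m × Bool) : Fin m → ℝ :=
  fun j => if j = r.1 then cEps ε * Real.sqrt m * sgn r.2 else 0

/-- The average of the vectors that a collection of reports stands for (zero if there are no
reports). -/
def average {m : ℕ} (ε : ℝ) (R : Multiset (Fin m × Bool)) : Fin m → ℝ :=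
  fun j => (R.map fun r => reportVec ε r j).sum / (Multiset.card R : ℝ)

/-! ### The server's side of the two sub-protocols -/

/-- Unique heavy hitter protocol: round the average of the reports to the hypercube and decode. -/
def ppDecode {d : ℕ} {ζ : ℝ} (code : BinaryCode d ζ) (ε : ℝ)
    (R : Multiset (Fin code.m × Bool)) : Fin d :=
  code.dec fun j => decide (0 ≤ average ε R j)

/-- The accuracy parameter `γ = √(log(2d/β) / (ε² n))` of the frequency oracle. -/
def foGamma (n d : ℕ) (ε β : ℝ) : ℝ := Real.sqrt (Real.log (2 * d / β) / (ε ^ 2 * n))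

/-- The dimension `m = log(d+1) log(2/β) / γ²` of the frequency oracle, rounded up to a positive
integer. -/
def foDim (n d : ℕ) (ε β : ℝ) : ℕ :=
  max 1 ⌈Real.log (d + 1) * Real.log (2 / β) / foGamma n d ε β ^ 2⌉₊

instance (n d : ℕ) (ε β : ℝ) : NeZero (foDim n d ε β) :=
  ⟨(lt_of_lt_of_le one_pos (le_max_left 1 _)).ne'⟩

/-- Frequency oracle: the estimate `⟨Φ e_v, z̄⟩`, where `Φ v` is the `v`-th column of the
projection matrix and `z̄` is the average of the reports. -/
def foEstimate {d m : ℕ} (ε : ℝ) (Φ : Fin d → Fin m → Bool) (R : Multiset (Fin m × Bool))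
    (v : Fin d) : ℝ :=
  ∑ j, vertex (Φ v) j * average ε R j

/-! ### The succinct histogram protocol -/

/-- A succinct histogram: a list of items, with estimated frequencies. -/
structure Histogram (d : ℕ) where
  list : Finset (Fin d)
  freq : Fin d → ℝ

/-- The estimated frequency of any item: items not on the list are implicitly estimated as `0`. -/
def Histogram.estimate {d : ℕ} (h : Histogram d) (v : Fin d) : ℝ :=
  if v ∈ h.list then h.freq v else 0

/-- The number of repetitions, `T = ⌈log(3/β)⌉`. -/
def rounds (β : ℝ) : ℕ := ⌈Real.log (3 / β)⌉₊

/-- The privacy parameter `ε / (2T + 1)` of each channel. -/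
def channelEps (ε β : ℝ) : ℝ := ε / (2 * rounds β + 1)

/-- The pruning threshold `((2T + 1) / ε) √(log d · log(1/β) / n)`. -/
def threshold (n d : ℕ) (ε β : ℝ) : ℝ :=
  (2 * rounds β + 1) / ε * Real.sqrt (Real.log d * Real.log (1 / β) / n)

/-- The dimension of the frequency oracle, which is run with parameters `ε/(2T+1)` and `β/3`. -/
abbrev shFoDim (n d : ℕ) (ε β : ℝ) : ℕ := foDim n d (channelEps ε β) (β / 3)

/-- The report of a user over the `T K` channels of the unique heavy hitter protocol, together
with its report in the channel of the frequency oracle. -/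
abbrev SHReport (T K m mFO : ℕ) : Type := (Fin T × Fin K → Fin m × Bool) × (Fin mFO × Bool)

/-- The succinct histogram protocol. The public coins are `T` independent uniform hash seeds and
an independent uniform sign matrix `Φ`. In channel `(t, k)` a user whose item `v` has hash value
`k` under the seed `s_t` randomizes the codeword of `v`, and every other user randomizes the zero
vector; in the last channel a user randomizes the column `Φ v`. The server decodes all channels
and lists those decoded items whose frequency, as estimated by the frequency oracle, reaches the
threshold. -/
def protSH {S : Type*} [Fintype S] [Nonempty S] (n : ℕ) {d K : ℕ} {ζ : ℝ} (ε β : ℝ)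
    (code : BinaryCode d ζ) (H : PairwiseIndepHash S d K) :
    LocalProtocol n (Fin d)
      ((Fin (rounds β) → S) × (Fin d → Fin (shFoDim n d ε β) → Bool))
      (SHReport (rounds β) K code.m (shFoDim n d ε β)) (Histogram d) where
  coins := PMF.uniformOfFintype _
  randomizer c _ v :=
    (indep fun tk : Fin (rounds β) × Fin K =>
        basicRandomizer (channelEps ε β)
          ((v.filter fun w => H.hash (c.1 tk.1) w = tk.2).map code.enc)).bind fun z =>
      (basicRandomizer (channelEps ε β) (v.map c.2)).map fun zFO => (z, zFO)
  server c R :=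
    let est : Fin d → ℝ :=
      foEstimate (channelEps ε β) c.2 (R.map fun r => r.2)
    { list := (Finset.univ.image fun tk : Fin (rounds β) × Fin K =>
          ppDecode code (channelEps ε β) (R.map fun r => r.1 tk)).filter
            fun v => threshold n d ε β ≤ est v
      freq := est }

/-- The frequency `f(v) = (1/n) #{i : v_i = v}`. -/
def frequency {n d : ℕ} (items : Fin n → Option (Fin d)) (v : Fin d) : ℝ :=
  ((Finset.univ.filter fun i => items i = some v).card : ℝ) / n

/-- The rate `(log^{3/2}(1/β) / ε) √(log d / n)`. -/
def rate (n d : ℕ) (ε β : ℝ) : ℝ :=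
  Real.log (1 / β) ^ (3 / 2 : ℝ) / ε * Real.sqrt (Real.log d / n)

/-- `h` is a good histogram for the frequencies `f` up to `e`, when the pruning threshold is `θ`:
for every cut-off `t ≥ θ`, all items of frequency at least `t + e` are on the list with an
estimate of at least `t`, and only items of frequency at least `t - e` are; and every estimate,
on or off the list, is off by at most `e`. (With `t = θ`, the list itself lies between
`{v | θ + e ≤ f v}` and `{v | θ - e ≤ f v}`.) -/
def IsAccurate {d : ℕ} (f : Fin d → ℝ) (θ e : ℝ) (h : Histogram d) : Prop :=
  (∀ t, θ ≤ t →
    {v | t + e ≤ f v} ⊆ {v | v ∈ h.list ∧ t ≤ h.estimate v} ∧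
    {v | v ∈ h.list ∧ t ≤ h.estimate v} ⊆ {v | t - e ≤ f v}) ∧
  ∀ v, |h.estimate v - f v| ≤ e

end SuccinctHistogram

end

/-! Privacy. Fix the public coins. Replacing no item by an item changes the randomizer's input only
in the `T` channels selected by the hash values and in the frequency-oracle channel, and in each of
them the mass of a report changes by a factor between `2/(e^ε' + 1)` and `2e^ε'/(e^ε' + 1)`. So `2
p_i` lies between the `(T+1)`-st powers `lo` and `hi` of these numbers. With `s = (T+1)ε'/2`, which
is at most `0.3 ε` because `T ≥ 2`, one has `lo ≥ 1 - s` and `hi ≤ 1/(1 - s)`. This controls the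
ratios for the bit `0`; for the bit `1`, `hi/lo = e^((T+1)ε') ≤ e^ε` (`acceptance_bounds`).

Simulation. The bit performs rejection sampling: a user accepts with probability exactly `1/2`, and
an accepted string has the law of the user's report in the original protocol (`expect_userLaw`).
Given the coins, the pairs (string, bit) are independent over users
(`LocalProtocol.oneBitOutput_eq`), so every sum over the collected strings is a sum of `n`
independent bounded variables, to which Hoeffding's inequality applies.

Error. Four failure events share the budget `β`: every round has a hash collision with a heavy item
(`β/3`, `expect_collisionSeeds_le`); two columns of `Φ` are too correlated (`β/6`,
`columnCorr_tail`); some frequency estimate is off (`β/3`, `rawEstimate_accurate`); some heavy item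
is not decoded in a collision-free round (`β/6`, `decodedItem_eq_of_heavy`). Outside them every item
of frequency at least `e` is a candidate, and uniformly good estimates make the pruned list accurate
(`isAccurate_of_estimates`). The number of collected strings is random, but only a lower bound `n/4`
is needed, since the deviations are centred at `f(v)` before dividing. The numerical section checks
that one constant `C`, depending on `ζ`, `ρ` and `log(1/β₀)`, serves all four estimates. -/

noncomputable section
namespace SuccinctHistogram

/-! ### Expectations over finite types -/

section Expectation

variable {α β : Type*} [Fintype α] [Fintype β]

/-- The expectation of a real function under a law on a finite type. -/
def expect (p : PMF α) (g : α → ℝ) : ℝ := ∑ a, (p a).toReal * g a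

lemma sum_toReal_eq_one (p : PMF α) : ∑ a, (p a).toReal = 1 := by
  rw [← ENNReal.toReal_sum fun a _ => p.apply_ne_top a,
    ← tsum_fintype (L := SummationFilter.unconditional _), p.tsum_coe, ENNReal.toReal_one]

lemma expect_const (p : PMF α) (r : ℝ) : expect p (fun _ => r) = r := by
  rw [expect, ← Finset.sum_mul, sum_toReal_eq_one, one_mul]

lemma expect_mono (p : PMF α) {g h : α → ℝ} (H : ∀ a, g a ≤ h a) : expect p g ≤ expect p h :=
  Finset.sum_le_sum fun a _ => mul_le_mul_of_nonneg_left (H a) ENNReal.toReal_nonneg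

lemma expect_add (p : PMF α) (g h : α → ℝ) :
    expect p (fun a => g a + h a) = expect p g + expect p h := by
  simp [expect, mul_add, Finset.sum_add_distrib]

lemma expect_sub (p : PMF α) (g h : α → ℝ) :
    expect p (fun a => g a - h a) = expect p g - expect p h := by
  simp [expect, mul_sub, Finset.sum_sub_distrib]

lemma expect_const_mul (p : PMF α) (r : ℝ) (g : α → ℝ) :
    expect p (fun a => r * g a) = r * expect p g := by
  simp only [expect, Finset.mul_sum]
  exact Finset.sum_congr rfl fun _ _ => by ring

lemma expect_neg (p : PMF α) (g : α → ℝ) : expect p (fun a => -g a) = -expect p g := by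
  simpa using expect_const_mul p (-1) g

lemma abs_expect_le (p : PMF α) {g : α → ℝ} {a : ℝ} (H : ∀ x, |g x| ≤ a) : |expect p g| ≤ a := by
  rw [abs_le]
  constructor
  · rw [← expect_const p (-a)]
    exact expect_mono p fun x => (abs_le.1 (H x)).1
  · rw [← expect_const p a]
    exact expect_mono p fun x => (abs_le.1 (H x)).2

lemma expect_pure (a : α) (g : α → ℝ) : expect (PMF.pure a) g = g a := by
  classical
  rw [expect, Finset.sum_eq_single a] <;> simp +contextual [PMF.pure_apply]

lemma expect_bind (p : PMF α) (q : α → PMF β) (g : β → ℝ) :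
    expect (p.bind q) g = expect p fun a => expect (q a) g := by
  simp only [expect, PMF.bind_apply, Finset.mul_sum]
  rw [Finset.sum_comm]
  refine Finset.sum_congr rfl fun b _ => ?_
  rw [tsum_fintype, ENNReal.toReal_sum fun a _ =>
    ENNReal.mul_ne_top (p.apply_ne_top a) ((q a).apply_ne_top b), Finset.sum_mul]
  exact Finset.sum_congr rfl fun a _ => by rw [ENNReal.toReal_mul]; ring

lemma expect_map (p : PMF α) (f : α → β) (g : β → ℝ) :
    expect (p.map f) g = expect p fun a => g (f a) := by
  rw [← PMF.bind_pure_comp, expect_bind]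
  simp [expect_pure]

lemma expect_uniform [Nonempty α] (g : α → ℝ) :
    expect (PMF.uniformOfFintype α) g = (∑ a, g a) / Fintype.card α := by
  simp [expect, ← Finset.mul_sum, div_eq_inv_mul]

/-- Markov's inequality, for a majorant of the indicator of the event. -/
lemma toOuterMeasure_le_expect (p : PMF α) (s : Set α) {g : α → ℝ} (h0 : ∀ a, 0 ≤ g a)
    (h1 : ∀ a ∈ s, 1 ≤ g a) : p.toOuterMeasure s ≤ ENNReal.ofReal (expect p g) := by
  rw [PMF.toOuterMeasure_apply_fintype, expect,
    ENNReal.ofReal_sum_of_nonneg fun a _ => mul_nonneg ENNReal.toReal_nonneg (h0 a)]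
  refine Finset.sum_le_sum fun a _ => ?_
  by_cases ha : a ∈ s
  · rw [Set.indicator_of_mem ha]
    nth_rewrite 1 [← ENNReal.ofReal_toReal (p.apply_ne_top a)]
    exact ENNReal.ofReal_le_ofReal (le_mul_of_one_le_right ENNReal.toReal_nonneg (h1 a ha))
  · simp [ha]

lemma toOuterMeasure_univ_eq_one {γ : Type*} (p : PMF γ) : p.toOuterMeasure Set.univ = 1 :=
  (p.toOuterMeasure_apply_eq_one_iff _).2 (Set.subset_univ _)

lemma ofReal_one_sub_le_of_compl {γ : Type*} (p : PMF γ) (s : Set γ) {b : ℝ} (hb : 0 ≤ b)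
    (h : p.toOuterMeasure sᶜ ≤ ENNReal.ofReal b) :
    ENNReal.ofReal (1 - b) ≤ p.toOuterMeasure s := by
  rw [ENNReal.ofReal_sub 1 hb, ENNReal.ofReal_one, tsub_le_iff_right]
  calc (1 : ℝ≥0∞) = p.toOuterMeasure (s ∪ sᶜ) := by
        rw [Set.union_compl_self, toOuterMeasure_univ_eq_one]
    _ ≤ p.toOuterMeasure s + p.toOuterMeasure sᶜ := MeasureTheory.measure_union_le _ _
    _ ≤ _ := by gcongr

/-- A two-stage experiment fails if the first stage is bad, or if the second stage fails after
a good first stage. -/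
lemma toOuterMeasure_bind_le {γ δ : Type*} (p : PMF γ) (q : γ → PMF δ) (bad : Set γ) (s : Set δ)
    (r : ℝ≥0∞) (h : ∀ a, a ∉ bad → (q a).toOuterMeasure s ≤ r) :
    (p.bind q).toOuterMeasure s ≤ p.toOuterMeasure bad + r := by
  rw [PMF.toOuterMeasure_bind_apply, PMF.toOuterMeasure_apply]
  calc ∑' a, p a * (q a).toOuterMeasure s ≤ ∑' a, (bad.indicator p a + p a * r) := by
        refine ENNReal.tsum_le_tsum fun a => ?_
        by_cases ha : a ∈ bad
        · rw [Set.indicator_of_mem ha]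
          refine le_add_right (mul_le_of_le_one_right' ?_)
          rw [← toOuterMeasure_univ_eq_one (q a)]
          exact MeasureTheory.measure_mono (Set.subset_univ s)
        · rw [Set.indicator_of_notMem ha, zero_add]
          gcongr
          exact h a ha
    _ = _ := by rw [ENNReal.tsum_add, ENNReal.tsum_mul_right, p.tsum_coe, one_mul]

/-- The union bound over a finite family of events. -/
lemma toOuterMeasure_iUnion_le {γ κ : Type*} [Fintype κ] (p : PMF γ) (s : κ → Set γ) {b : ℝ}
    (h : ∀ k, p.toOuterMeasure (s k) ≤ ENNReal.ofReal b) :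
    p.toOuterMeasure (⋃ k, s k) ≤ ENNReal.ofReal (Fintype.card κ * b) := by
  calc p.toOuterMeasure (⋃ k, s k) ≤ ∑ k, p.toOuterMeasure (s k) :=
        MeasureTheory.measure_iUnion_fintype_le _ _
    _ ≤ ∑ _k : κ, ENNReal.ofReal b := Finset.sum_le_sum fun k _ => h k
    _ = _ := by
      rw [Finset.sum_const, nsmul_eq_mul, ENNReal.ofReal_mul (Nat.cast_nonneg _),
        ENNReal.ofReal_natCast, Finset.card_univ]

end Expectation

/-! ### Independent families -/

section Independence

variable {α β γ ι : Type*} [Fintype α] [Fintype β] [Fintype ι] [DecidableEq ι]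

lemma indep_apply (p : ι → PMF α) (ω : ι → α) : indep p ω = ∏ i, p i (ω i) := rfl

lemma expect_indep_prod (p : ι → PMF α) (g : ι → α → ℝ) :
    expect (indep p) (fun ω => ∏ i, g i (ω i)) = ∏ i, expect (p i) (g i) := by
  simp only [expect]
  rw [Fintype.prod_sum]
  refine Finset.sum_congr rfl fun ω _ => ?_
  rw [indep_apply, ENNReal.toReal_prod, Finset.prod_mul_distrib]

lemma expect_indep_apply (p : ι → PMF α) (k : ι) (g : α → ℝ) :
    expect (indep p) (fun ω => g (ω k)) = expect (p k) g := by
  have h := expect_indep_prod p fun i a => if i = k then g a else 1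
  simp only [Finset.prod_ite_eq', Finset.mem_univ, if_true] at h
  rw [h, Finset.prod_eq_single k]
  · simp
  · intro i _ hi
    simp [hi, expect_const]
  · simp

lemma bind_map_prodMk_apply (p : PMF γ) (q : γ → PMF β) (y : γ) (b : β) :
    (p.bind fun y => (q y).map (y, ·)) (y, b) = p y * q y b := by
  classical
  rw [PMF.bind_apply, tsum_eq_single y]
  · congr 1
    rw [PMF.map_apply, tsum_eq_single b]
    · simp
    · intro b' hb'
      simp [Ne.symm hb']
  · intro y' hy'
    rw [PMF.map_apply]
    simp [Ne.symm hy']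

/-- Drawing all first components and then all second components of independent pairs is the same
as drawing the pairs independently. -/
lemma indep_bind_indep (p : ι → PMF α) (q : ι → α → PMF β) (F : (ι → α) → (ι → β) → γ) :
    ((indep p).bind fun y => (indep fun i => q i (y i)).map (F y)) =
      (indep fun i => (p i).bind fun y => (q i y).map (y, ·)).map
        fun ω => F (fun i => (ω i).1) (fun i => (ω i).2) := by
  classical
  have key : (indep fun i => (p i).bind fun y => (q i y).map (y, ·)) =
      ((indep p).bind fun y => (indep fun i => q i (y i)).map (y, ·)).map
        fun yb i => (yb.1 i, yb.2 i) := by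
    ext ω
    rw [PMF.map_apply, tsum_eq_single (fun i => (ω i).1, fun i => (ω i).2)]
    · simp only [if_true, Prod.mk.eta]
      rw [bind_map_prodMk_apply, indep_apply, indep_apply, indep_apply, ← Finset.prod_mul_distrib]
      exact Finset.prod_congr rfl fun i _ => bind_map_prodMk_apply _ _ _ _
    · rintro ⟨y, b⟩ h
      rw [if_neg]
      rintro rfl
      exact h rfl
  rw [key, PMF.map_comp, PMF.map_bind]
  simp only [PMF.map_comp]
  rfl

/-- Convexity: `exp` lies below its chord over the interval between `-ta` and `ta`, and `ty` is the
convex combination with weights `(a ± y)/(2a)`. -/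
lemma exp_mul_le_cosh_add {a y t : ℝ} (ha : 0 < a) (hy : |y| ≤ a) :
    Real.exp (t * y) ≤ Real.cosh (t * a) + y * (Real.sinh (t * a) / a) := by
  obtain ⟨h1, h2⟩ := abs_le.1 hy
  have h := convexOn_exp.2 (Set.mem_univ (t * a)) (Set.mem_univ (-(t * a)))
    (show 0 ≤ (a + y) / (2 * a) from div_nonneg (by linarith) (by linarith))
    (show 0 ≤ (a - y) / (2 * a) from div_nonneg (by linarith) (by linarith))
    (by field_simp; ring)
  have e : ((a + y) / (2 * a)) • (t * a) + ((a - y) / (2 * a)) • (-(t * a)) = t * y := by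
    simp only [smul_eq_mul]; field_simp; ring
  rw [e] at h
  refine h.trans_eq ?_
  rw [Real.cosh_eq, Real.sinh_eq]
  simp only [smul_eq_mul]
  field_simp
  ring

/-- Hoeffding's lemma: the linear term of the chord bound has mean zero, and `cosh x ≤ exp (x²/2)`.
-/
lemma expect_exp_mul_le (p : PMF α) {Y : α → ℝ} {a : ℝ} (ha : 0 < a) (hY : ∀ x, |Y x| ≤ a)
    (h0 : expect p Y = 0) (t : ℝ) :
    expect p (fun x => Real.exp (t * Y x)) ≤ Real.exp ((t * a) ^ 2 / 2) := by
  calc expect p (fun x => Real.exp (t * Y x))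
      ≤ expect p (fun x => Real.cosh (t * a) + (Real.sinh (t * a) / a) * Y x) :=
        expect_mono p fun x => (exp_mul_le_cosh_add ha (hY x)).trans_eq (by ring)
    _ = Real.cosh (t * a) := by rw [expect_add, expect_const, expect_const_mul, h0]; ring
    _ ≤ _ := Real.cosh_le_exp_half_sq _

/-- Hoeffding's inequality for the upper tail. -/
theorem indep_upper_tail (p : ι → PMF α) (X : ι → α → ℝ) {a s : ℝ} (ha : 0 < a) (hs : 0 ≤ s)
    (hX : ∀ i x, |X i x| ≤ a) :
    (indep p).toOuterMeasure {ω | ∑ i, expect (p i) (X i) + s ≤ ∑ i, X i (ω i)} ≤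
      ENNReal.ofReal (Real.exp (-(s ^ 2 / (8 * Fintype.card ι * a ^ 2)))) := by
  set N : ℝ := (Fintype.card ι : ℝ) with hN
  -- Centring doubles the range to `2a`, so the exponent to be minimised is `-ts + 2N t² a²`; this
  -- `t` is the minimiser. For `N = 0` it is `0` by the convention for division, and the bound is
  -- trivial.
  set t : ℝ := s / (4 * N * a ^ 2) with ht
  have ht0 : 0 ≤ t := by positivity
  set Y : ι → α → ℝ := fun i x => X i x - expect (p i) (X i) with hYdef
  have hY : ∀ i x, |Y i x| ≤ 2 * a := fun i x => by
    have h1 := hX i x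
    have h2 := abs_expect_le (p i) (hX i)
    calc |Y i x| ≤ |X i x| + |expect (p i) (X i)| := abs_sub _ _
      _ ≤ _ := by linarith
  have hY0 : ∀ i, expect (p i) (Y i) = 0 := fun i => by
    rw [hYdef, expect_sub, expect_const, sub_self]
  refine (toOuterMeasure_le_expect _ _
    (g := fun ω => Real.exp (-(t * s)) * ∏ i, Real.exp (t * Y i (ω i)))
    (fun ω => by positivity) ?_).trans (ENNReal.ofReal_le_ofReal ?_)
  · intro ω hω
    rw [Set.mem_ofPred_eq] at hω
    rw [← Real.exp_sum, ← Real.exp_add, Real.one_le_exp_iff, ← Finset.mul_sum]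
    have : ∑ i, Y i (ω i) = ∑ i, X i (ω i) - ∑ i, expect (p i) (X i) := by
      simp [hYdef]
    rw [this]
    nlinarith
  · rw [expect_const_mul, expect_indep_prod p fun i x => Real.exp (t * Y i x)]
    calc Real.exp (-(t * s)) * ∏ i, expect (p i) (fun x => Real.exp (t * Y i x))
        ≤ Real.exp (-(t * s)) * ∏ _i : ι, Real.exp ((t * (2 * a)) ^ 2 / 2) := by
          gcongr with i
          · intro i _
            exact Finset.sum_nonneg fun x _ => mul_nonneg ENNReal.toReal_nonneg (Real.exp_nonneg _)
          · exact expect_exp_mul_le (p i) (by linarith) (hY i) (hY0 i) t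
      _ = Real.exp (-(s ^ 2 / (8 * N * a ^ 2))) := by
          rw [Finset.prod_const, Finset.card_univ, ← Real.exp_nat_mul, ← Real.exp_add, ← hN]
          congr 1
          rcases eq_or_ne N 0 with h | h
          · simp [ht, h]
          · rw [ht]
            field_simp
            ring

/-- Hoeffding's inequality for the lower tail. -/
theorem indep_lower_tail (p : ι → PMF α) (X : ι → α → ℝ) {a s : ℝ} (ha : 0 < a) (hs : 0 ≤ s)
    (hX : ∀ i x, |X i x| ≤ a) :
    (indep p).toOuterMeasure {ω | ∑ i, X i (ω i) ≤ ∑ i, expect (p i) (X i) - s} ≤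
      ENNReal.ofReal (Real.exp (-(s ^ 2 / (8 * Fintype.card ι * a ^ 2)))) := by
  refine le_trans (MeasureTheory.measure_mono ?_)
    (indep_upper_tail p (fun i x => -X i x) ha hs fun i x => by rw [abs_neg]; exact hX i x)
  intro ω hω
  simp only [Set.mem_ofPred_eq, expect_neg, Finset.sum_neg_distrib] at hω ⊢
  linarith

/-- Hoeffding's inequality for both tails. -/
theorem indep_two_tails (p : ι → PMF α) (X : ι → α → ℝ) {a s : ℝ} (ha : 0 < a) (hs : 0 ≤ s)
    (hX : ∀ i x, |X i x| ≤ a) :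
    (indep p).toOuterMeasure {ω | s ≤ |∑ i, X i (ω i) - ∑ i, expect (p i) (X i)|} ≤
      ENNReal.ofReal (2 * Real.exp (-(s ^ 2 / (8 * Fintype.card ι * a ^ 2)))) := by
  rw [two_mul, ENNReal.ofReal_add (Real.exp_nonneg _) (Real.exp_nonneg _)]
  refine le_trans (MeasureTheory.measure_mono ?_) ((MeasureTheory.measure_union_le _ _).trans
    (add_le_add (indep_upper_tail p X ha hs hX) (indep_lower_tail p X ha hs hX)))
  intro ω hω
  rcases le_abs.1 (Set.mem_ofPred_eq ▸ hω) with h | h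
  · exact Or.inl (by rw [Set.mem_ofPred_eq]; linarith)
  · exact Or.inr (by rw [Set.mem_ofPred_eq]; linarith)

/-- The indicator of the event is the product of the coordinate indicators, and the expectation of a
product factorises. -/
lemma indep_toOuterMeasure_forall_le (p : ι → PMF α) (s : Set α)
    [DecidablePred (· ∈ s)] {b : ℝ} (h : ∀ i, expect (p i) (fun a => if a ∈ s then 1 else 0) ≤ b) :
    (indep p).toOuterMeasure {ω | ∀ i, ω i ∈ s} ≤ ENNReal.ofReal (b ^ Fintype.card ι) := by
  refine (toOuterMeasure_le_expect _ _ (g := fun ω => ∏ i, if ω i ∈ s then (1 : ℝ) else 0)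
    (fun ω => Finset.prod_nonneg fun i _ => by split_ifs <;> norm_num) fun ω hω => ?_).trans
    (ENNReal.ofReal_le_ofReal ?_)
  · have : ∀ i, ω i ∈ s := hω
    simp [this]
  · rw [expect_indep_prod p fun _ a => if a ∈ s then (1 : ℝ) else 0, ← Finset.card_univ,
      ← Finset.prod_const]
    refine Finset.prod_le_prod (fun i _ => ?_) fun i _ => h i
    refine (expect_const (p i) 0).symm.trans_le (expect_mono _ fun a => ?_)
    split_ifs <;> norm_num

end Independence

/-! ### The mass functions of the randomizers -/

section BasicRandomizer

variable {m : ℕ} [NeZero m]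

lemma coin_toReal_true {p : ℝ≥0∞} (hp : p ≤ 1) : (coin p true).toReal = p.toReal := by
  simp [coin, hp]

lemma coin_toReal_false {p : ℝ≥0∞} (hp : p ≤ 1) : (coin p false).toReal = 1 - p.toReal := by
  simp [coin, hp, ENNReal.toReal_sub_of_le hp]

/-- A coin with values in `Bool`, flipped onto a given bit. -/
lemma expect_coin {p : ℝ≥0∞} (hp : p ≤ 1) (g : Bool → ℝ) :
    expect (coin p) g = p.toReal * g true + (1 - p.toReal) * g false := by
  simp [expect, coin_toReal_true hp, coin_toReal_false hp]

lemma keepProb_le_one (ε : ℝ) : ENNReal.ofReal (Real.exp ε / (Real.exp ε + 1)) ≤ 1 := by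
  rw [ENNReal.ofReal_le_one, div_le_one (by positivity)]
  linarith

lemma keepProb_toReal (ε : ℝ) :
    (ENNReal.ofReal (Real.exp ε / (Real.exp ε + 1))).toReal = Real.exp ε / (Real.exp ε + 1) :=
  ENNReal.toReal_ofReal (by positivity)

lemma expect_basicRandomizer_none (ε : ℝ) (g : Fin m × Bool → ℝ) :
    expect (basicRandomizer ε (none : Option (Fin m → Bool))) g =
      (∑ j, (g (j, true) + g (j, false)) / 2) / m := by
  simp [basicRandomizer, expect_bind, expect_map, expect_uniform]

lemma expect_basicRandomizer_some (ε : ℝ) (x : Fin m → Bool) (g : Fin m × Bool → ℝ) :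
    expect (basicRandomizer ε (some x)) g =
      (∑ j, (Real.exp ε / (Real.exp ε + 1) * g (j, x j) +
        1 / (Real.exp ε + 1) * g (j, !(x j)))) / m := by
  have h : 1 - Real.exp ε / (Real.exp ε + 1) = 1 / (Real.exp ε + 1) := by
    have := Real.exp_pos ε
    field_simp
    ring
  simp only [basicRandomizer, expect_bind, expect_map, expect_uniform, Fintype.card_fin,
    expect_coin (keepProb_le_one ε), keepProb_toReal, h]
  simp

lemma toReal_eq_expect {α : Type*} [Fintype α] [DecidableEq α] (p : PMF α) (a : α) :
    (p a).toReal = expect p fun x => if x = a then 1 else 0 := by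
  simp [expect]

lemma basicRandomizer_none_toReal (ε : ℝ) (r : Fin m × Bool) :
    (basicRandomizer ε (none : Option (Fin m → Bool)) r).toReal = 1 / (2 * m) := by
  rw [toReal_eq_expect, expect_basicRandomizer_none, Finset.sum_eq_single r.1]
  · obtain ⟨j, b⟩ := r
    cases b <;> simp [div_eq_mul_inv, mul_comm]
  · intro j _ hj
    simp [Prod.ext_iff, hj]
  · simp

/-- The largest and the smallest ratio of the probability of a report to its probability when
the input is the zero vector. -/
lemma basicRandomizer_toReal_mem (ε : ℝ) (hε : 0 ≤ ε) (x : Option (Fin m → Bool))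
    (r : Fin m × Bool) :
    2 / (Real.exp ε + 1) * (1 / (2 * m)) ≤ (basicRandomizer ε x r).toReal ∧
      (basicRandomizer ε x r).toReal ≤ 2 * Real.exp ε / (Real.exp ε + 1) * (1 / (2 * m)) := by
  have hm : (0 : ℝ) < m := Nat.cast_pos.2 (NeZero.pos m)
  have hu : 1 ≤ Real.exp ε := Real.one_le_exp hε
  have hlo : 2 / (Real.exp ε + 1) ≤ 1 := by rw [div_le_one] <;> linarith
  have hhi : 1 ≤ 2 * Real.exp ε / (Real.exp ε + 1) := by rw [one_le_div] <;> linarith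
  have hm' : (0 : ℝ) ≤ 1 / (2 * m) := by positivity
  rcases x with _ | x
  · rw [basicRandomizer_none_toReal]
    constructor <;> nlinarith
  · have h : (basicRandomizer ε (some x) r).toReal =
        (2 * (if r.2 = x r.1 then Real.exp ε else 1)) / (Real.exp ε + 1) * (1 / (2 * m)) := by
      rw [toReal_eq_expect, expect_basicRandomizer_some, Finset.sum_eq_single r.1]
      · obtain ⟨j, b⟩ := r
        cases b <;> cases hx : x j <;> simp <;> field_simp
      · intro j _ hj
        simp [Prod.ext_iff, hj]
      · simp
    rw [h]
    constructor
    · gcongr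
      split_ifs <;> linarith
    · gcongr
      split_ifs <;> linarith

end BasicRandomizer

/-! ### Privacy of the 1-bit protocol -/

section Privacy

variable {S : Type*} [Fintype S] [Nonempty S] {n d K : ℕ} {ζ ε β : ℝ}
  (code : BinaryCode d ζ) (H : PairwiseIndepHash S d K)

lemma protSH_randomizer_toReal (c) (i : Fin n) (v : Option (Fin d))
    (y : SHReport (rounds β) K code.m (shFoDim n d ε β)) :
    ((protSH n ε β code H).randomizer c i v y).toReal =
      (∏ tk : Fin (rounds β) × Fin K, (basicRandomizer (channelEps ε β)
          ((v.filter fun w => H.hash (c.1 tk.1) w = tk.2).map code.enc) (y.1 tk)).toReal) *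
        (basicRandomizer (channelEps ε β) (v.map c.2) y.2).toReal := by
  obtain ⟨z, zFO⟩ := y
  simp only [protSH]
  rw [bind_map_prodMk_apply _ (fun _ => basicRandomizer (channelEps ε β) (v.map c.2)),
    indep_apply, ENNReal.toReal_mul, ENNReal.toReal_prod]

lemma channelEps_nonneg (hε : 0 ≤ ε) : 0 ≤ channelEps ε β := by
  unfold channelEps
  positivity

/-- In the `T` channels selected by the hash values of an item and in the channel of the
frequency oracle, the probability of a report changes by a bounded factor. -/
lemma protSH_randomizer_mem (hε : 0 ≤ ε) (c) (i : Fin n) (v : Option (Fin d))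
    (y : SHReport (rounds β) K code.m (shFoDim n d ε β)) :
    (2 / (Real.exp (channelEps ε β) + 1)) ^ (rounds β + 1) *
        ((protSH n ε β code H).randomizer c i none y).toReal ≤
      ((protSH n ε β code H).randomizer c i v y).toReal ∧
    ((protSH n ε β code H).randomizer c i v y).toReal ≤
      (2 * Real.exp (channelEps ε β) / (Real.exp (channelEps ε β) + 1)) ^ (rounds β + 1) *
        ((protSH n ε β code H).randomizer c i none y).toReal := by
  have hx := channelEps_nonneg (β := β) hε
  set x := channelEps ε β
  have hu : 1 ≤ Real.exp x := Real.one_le_exp hx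
  set lo := 2 / (Real.exp x + 1)
  set hi := 2 * Real.exp x / (Real.exp x + 1)
  have hlo0 : 0 ≤ lo := by positivity
  have hhi0 : 0 ≤ hi := by positivity
  have hlo : lo ≤ 1 := by rw [div_le_one] <;> linarith
  have hhi : 1 ≤ hi := by rw [one_le_div] <;> linarith
  simp only [protSH_randomizer_toReal]
  rcases v with _ | w
  · have h0 : 0 ≤ (∏ tk : Fin (rounds β) × Fin K, (basicRandomizer x
          (((none : Option (Fin d)).filter fun w => H.hash (c.1 tk.1) w = tk.2).map code.enc)
            (y.1 tk)).toReal) * (basicRandomizer x ((none : Option (Fin d)).map c.2) y.2).toReal :=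
      mul_nonneg (Finset.prod_nonneg fun _ _ => ENNReal.toReal_nonneg) ENNReal.toReal_nonneg
    exact ⟨mul_le_of_le_one_left h0 (pow_le_one₀ hlo0 hlo),
      le_mul_of_one_le_left h0 (one_le_pow₀ hhi)⟩
  -- For each round `t` exactly one `k` is the hash value of `w`, so exactly `T` of the `T K`
  -- factors differ from `1`. This allows a comparison channel by channel.
  · have hpow : ∀ r : ℝ, r ^ rounds β =
        ∏ tk : Fin (rounds β) × Fin K, if H.hash (c.1 tk.1) w = tk.2 then r else 1 := by
      intro r
      rw [Fintype.prod_prod_type]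
      simp
    have hk : ∀ tk : Fin (rounds β) × Fin K,
        (if H.hash (c.1 tk.1) w = tk.2 then lo else 1) *
          (basicRandomizer x (none : Option (Fin code.m → Bool)) (y.1 tk)).toReal ≤
        (basicRandomizer x (((some w).filter fun w => H.hash (c.1 tk.1) w = tk.2).map code.enc)
          (y.1 tk)).toReal ∧
        (basicRandomizer x (((some w).filter fun w => H.hash (c.1 tk.1) w = tk.2).map code.enc)
          (y.1 tk)).toReal ≤
        (if H.hash (c.1 tk.1) w = tk.2 then hi else 1) *
          (basicRandomizer x (none : Option (Fin code.m → Bool)) (y.1 tk)).toReal := by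
      intro tk
      by_cases h : H.hash (c.1 tk.1) w = tk.2
      · simp only [h, if_true, basicRandomizer_none_toReal]
        exact basicRandomizer_toReal_mem x hx _ _
      · simp [h, Option.filter]
    have hfo := basicRandomizer_toReal_mem x hx ((some w).map c.2) y.2
    rw [← basicRandomizer_none_toReal x y.2] at hfo
    have hnn : ∀ tk : Fin (rounds β) × Fin K, 0 ≤
        (basicRandomizer x (none : Option (Fin code.m → Bool)) (y.1 tk)).toReal :=
      fun _ => ENNReal.toReal_nonneg
    have hfn : 0 ≤ (basicRandomizer x (none : Option (Fin (shFoDim n d ε β) → Bool)) y.2).toReal :=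
      ENNReal.toReal_nonneg
    simp only [Option.filter_none, Option.map_none]
    rw [pow_succ, pow_succ, hpow lo, hpow hi, mul_mul_mul_comm, mul_mul_mul_comm _ hi,
      ← Finset.prod_mul_distrib, ← Finset.prod_mul_distrib]
    constructor
    · refine mul_le_mul (Finset.prod_le_prod (fun tk _ => mul_nonneg ?_ (hnn tk))
        fun tk _ => (hk tk).1) hfo.1 (mul_nonneg hlo0 hfn)
        (Finset.prod_nonneg fun _ _ => ENNReal.toReal_nonneg)
      split_ifs <;> linarith
    · refine mul_le_mul (Finset.prod_le_prod (fun tk _ => ENNReal.toReal_nonneg)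
        fun tk _ => (hk tk).2) hfo.2 ENNReal.toReal_nonneg
        (Finset.prod_nonneg fun tk _ => mul_nonneg ?_ (hnn tk))
      split_ifs <;> linarith

/-- Every string is possible under `⊥`, so the quotient in the acceptance probability never divides
by zero. -/
lemma protSH_randomizer_none_pos (c) (i : Fin n)
    (y : SHReport (rounds β) K code.m (shFoDim n d ε β)) :
    0 < ((protSH n ε β code H).randomizer c i none y).toReal := by
  rw [protSH_randomizer_toReal]
  have h : ∀ m : ℕ, m ≠ 0 → (0 : ℝ) < 1 / (2 * m) := fun m hm => by positivity
  refine mul_pos (Finset.prod_pos fun tk _ => ?_) ?_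
  · rw [Option.filter_none, Option.map_none, basicRandomizer_none_toReal]
    exact h _ (NeZero.ne _)
  · rw [Option.map_none, basicRandomizer_none_toReal]
    exact h _ (NeZero.ne _)

lemma protSH_acceptProb_toReal (c) (i : Fin n) (v : Option (Fin d))
    (y : SHReport (rounds β) K code.m (shFoDim n d ε β)) :
    ((protSH n ε β code H).acceptProb c i y v).toReal =
      1 / 2 * (((protSH n ε β code H).randomizer c i v y).toReal /
        ((protSH n ε β code H).randomizer c i none y).toReal) := by
  rw [LocalProtocol.acceptProb, ENNReal.toReal_mul, ENNReal.toReal_div, ENNReal.toReal_div]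
  simp

lemma protSH_acceptProb_toReal_mem (hε : 0 ≤ ε) (c) (i : Fin n) (v : Option (Fin d))
    (y : SHReport (rounds β) K code.m (shFoDim n d ε β)) :
    (2 / (Real.exp (channelEps ε β) + 1)) ^ (rounds β + 1) / 2 ≤
      ((protSH n ε β code H).acceptProb c i y v).toReal ∧
    ((protSH n ε β code H).acceptProb c i y v).toReal ≤
      (2 * Real.exp (channelEps ε β) / (Real.exp (channelEps ε β) + 1)) ^ (rounds β + 1) / 2 := by
  have h := protSH_randomizer_mem code H hε c i v y
  have h0 := protSH_randomizer_none_pos (ε := ε) (β := β) code H c i y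
  rw [protSH_acceptProb_toReal]
  rw [← le_div_iff₀ h0, ← div_le_iff₀ h0] at h
  constructor <;> linarith

lemma two_le_rounds (hβ : 0 < β) (hβ1 : β < 1) : 2 ≤ rounds β := by
  unfold rounds
  rw [Nat.succ_le_iff, Nat.lt_ceil, Nat.cast_one, Real.lt_log_iff_exp_lt (by positivity)]
  calc Real.exp 1 < 3 := by linarith [Real.exp_one_lt_d9]
    _ ≤ 3 / β := by rw [le_div_iff₀ hβ]; nlinarith

/-- The numerical inequalities behind the privacy of the 1-bit protocol. -/
lemma acceptance_bounds (hε : 0 < ε) (hε2 : ε ≤ Real.log 2) (hβ : 0 < β) (hβ1 : β < 1)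
    {lo hi : ℝ} (hlo : lo = (2 / (Real.exp (channelEps ε β) + 1)) ^ (rounds β + 1))
    (hhi : hi = (2 * Real.exp (channelEps ε β) / (Real.exp (channelEps ε β) + 1)) ^
      (rounds β + 1)) :
    hi ≤ 2 ∧ hi ≤ Real.exp ε * lo ∧ 1 - lo / 2 ≤ Real.exp ε * (1 - hi / 2) := by
  have hT : (2 : ℝ) ≤ rounds β := by exact_mod_cast two_le_rounds hβ hβ1
  have hεT : ε = (2 * rounds β + 1) * channelEps ε β := by
    unfold channelEps
    field_simp
  have hx : 0 < channelEps ε β := by unfold channelEps; positivity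
  set x := channelEps ε β
  set T : ℝ := (rounds β : ℝ)
  have hlog2 : Real.log 2 < 0.7 := by linarith [Real.log_two_lt_d9]
  set s := (T + 1) * x / 2 with hs
  have hs0 : 0 ≤ s := by positivity
  -- `(T+1)/(2(2T+1)) ≤ 3/10` holds exactly when `T ≥ 2`.
  have hsε : s ≤ 0.3 * ε := by rw [hs, hεT]; nlinarith
  have hu : 1 < Real.exp x := Real.one_lt_exp_iff.2 hx
  have hw : Real.exp x = Real.exp (x / 2) * Real.exp (x / 2) := by
    rw [← Real.exp_add]; congr 1; ring
  have hhi_le : hi ≤ Real.exp s := by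
    -- This is `2 e^(x/2) ≤ e^x + 1`, that is, `(e^(x/2) - 1)² ≥ 0`.
    have h1 : 2 * Real.exp x / (Real.exp x + 1) ≤ Real.exp (x / 2) := by
      rw [div_le_iff₀ (by positivity), hw]
      nlinarith [mul_nonneg (Real.exp_pos (x / 2)).le (sq_nonneg (Real.exp (x / 2) - 1))]
    calc hi ≤ Real.exp (x / 2) ^ (rounds β + 1) := by rw [hhi]; gcongr
      _ = Real.exp s := by
        rw [← Real.exp_nat_mul]
        congr 1
        push_cast
        rw [hs]
        ring
  have hlo_ge : 1 - s ≤ lo := by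
    -- Equivalent to `tanh (x/2) ≤ x/2`; it comes from `log (1 + y) ≥ 2y/(y + 2)` at `y = e^x - 1`.
    -- Bernoulli's inequality then handles the power.
    have h1 : 1 - x / 2 ≤ 2 / (Real.exp x + 1) := by
      have h := Real.le_log_one_add_of_nonneg (x := Real.exp x - 1) (by linarith)
      rw [add_sub_cancel, Real.log_exp, div_le_iff₀ (by linarith)] at h
      rw [le_div_iff₀ (by positivity)]
      linarith
    have h2 := one_add_mul_le_pow (a := -(x / 2)) (by nlinarith) (rounds β + 1)
    push_cast at h2
    calc 1 - s = 1 + (T + 1) * -(x / 2) := by rw [hs]; ring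
      _ ≤ (1 + -(x / 2)) ^ (rounds β + 1) := h2
      _ ≤ lo := by
        rw [hlo]
        refine pow_le_pow_left₀ (by nlinarith) (by linarith) _
  have hexp : hi ≤ 1 / (1 - s) := by
    refine hhi_le.trans ?_
    rw [le_div_iff₀ (by nlinarith)]
    have h1 := Real.add_one_le_exp (-s)
    calc Real.exp s * (1 - s) ≤ Real.exp s * Real.exp (-s) := by gcongr; linarith
      _ = 1 := by rw [← Real.exp_add]; simp
  have hhi2 : hi ≤ 2 := hexp.trans (by rw [div_le_iff₀ (by nlinarith)]; nlinarith)
  refine ⟨hhi2, ?_, ?_⟩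
  -- The bit `1`: the ratio is `e^((T+1)x)`, and `(T+1)x ≤ (2T+1)x = ε`.
  · have h1 : hi = Real.exp x ^ (rounds β + 1) * lo := by
      rw [hlo, hhi, ← mul_pow]
      congr 1
      ring
    have h0 : 0 ≤ lo := by rw [hlo]; positivity
    rw [h1, ← Real.exp_nat_mul]
    gcongr
    push_cast
    nlinarith
  -- The bit `0`: using `e^ε ≥ 1 + ε` and the bounds on `lo` and `hi` in terms of `s`, the claim
  -- reduces to `1 - s² ≤ (1 + ε)(1 - 2s)`, which follows from `s ≤ 0.3 ε` and `ε < 0.7`.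
  · have h1 := Real.add_one_le_exp ε
    have h2 : 1 - hi / 2 ≥ 1 - 1 / (1 - s) / 2 := by linarith
    have h3 : (1 + ε) * (1 - 1 / (1 - s) / 2) ≤ Real.exp ε * (1 - hi / 2) := by
      refine mul_le_mul (by linarith) h2 ?_ (Real.exp_nonneg _)
      have : 1 / (1 - s) ≤ 2 := by rw [div_le_iff₀ (by nlinarith)]; nlinarith
      linarith
    refine le_trans ?_ h3
    have h4 : (1 + ε) * (1 - 1 / (1 - s) / 2) = (1 + ε) * (1 - 2 * s) / (2 * (1 - s)) := by
      have : 1 - s ≠ 0 := by nlinarith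
      field_simp
      ring
    rw [h4, le_div_iff₀ (by nlinarith)]
    have h5 : 1 - lo / 2 ≤ (1 + s) / 2 := by linarith
    have h6 : (1 - lo / 2) * (2 * (1 - s)) ≤ (1 + s) / 2 * (2 * (1 - s)) := by
      gcongr
      nlinarith
    nlinarith

lemma protSH_acceptProb_le_one (hε : 0 < ε) (hε2 : ε ≤ Real.log 2) (hβ : 0 < β) (hβ1 : β < 1)
    (c) (i : Fin n) (v : Option (Fin d))
    (y : SHReport (rounds β) K code.m (shFoDim n d ε β)) :
    (protSH n ε β code H).acceptProb c i y v ≤ 1 := by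
  have h := (protSH_acceptProb_toReal_mem code H hε.le c i v y).2
  have h2 := (acceptance_bounds hε hε2 hβ hβ1 rfl rfl).1
  have hfin : (protSH n ε β code H).acceptProb c i y v ≠ ⊤ := by
    have h0 := protSH_randomizer_none_pos (ε := ε) (β := β) code H c i y
    rw [LocalProtocol.acceptProb]
    refine ENNReal.mul_ne_top (by simp) (ENNReal.div_ne_top (PMF.apply_ne_top _ _) ?_)
    rintro h'
    simp [h'] at h0
  rw [← ENNReal.ofReal_toReal hfin, ENNReal.ofReal_le_one]
  linarith

lemma isLocallyPrivate_of_apply_le {V Z : Type*} [Fintype Z] {ε : ℝ} {Q : V → PMF Z}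
    (h : ∀ v v' z, (Q v z).toReal ≤ Real.exp ε * (Q v' z).toReal) : IsLocallyPrivate ε Q := by
  intro v v' A
  rw [PMF.toOuterMeasure_apply_fintype, PMF.toOuterMeasure_apply_fintype, Finset.mul_sum]
  refine Finset.sum_le_sum fun z _ => ?_
  by_cases hz : z ∈ A
  · rw [Set.indicator_of_mem hz, Set.indicator_of_mem hz,
      ← ENNReal.ofReal_toReal ((Q v).apply_ne_top z),
      ← ENNReal.ofReal_toReal ((Q v').apply_ne_top z), ← ENNReal.ofReal_mul (Real.exp_nonneg _)]
    exact ENNReal.ofReal_le_ofReal (h v v' z)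
  · simp [hz]

theorem protSH_oneBitRandomizer_isLocallyPrivate (hε : 0 < ε) (hε2 : ε ≤ Real.log 2) (hβ : 0 < β)
    (hβ1 : β < 1) (c) (i : Fin n) (y : SHReport (rounds β) K code.m (shFoDim n d ε β)) :
    IsLocallyPrivate ε ((protSH n ε β code H).oneBitRandomizer c i y) := by
  refine isLocallyPrivate_of_apply_le fun v v' b => ?_
  have hle := protSH_acceptProb_le_one code H hε hε2 hβ hβ1 c i
  have hv := protSH_acceptProb_toReal_mem code H hε.le c i v y
  have hv' := protSH_acceptProb_toReal_mem code H hε.le c i v' y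
  obtain ⟨-, h1, h2⟩ := acceptance_bounds hε hε2 hβ hβ1 rfl rfl
  have he := Real.exp_pos ε
  cases b
  · simp only [LocalProtocol.oneBitRandomizer, coin_toReal_false (hle _ y)]
    refine le_trans ?_ (h2.trans ?_)
    · linarith
    · gcongr
      linarith
  · simp only [LocalProtocol.oneBitRandomizer, coin_toReal_true (hle _ y)]
    calc _ ≤ _ := hv.2
      _ ≤ Real.exp ε *
          ((2 / (Real.exp (channelEps ε β) + 1)) ^ (rounds β + 1) / 2) := by linarith
      _ ≤ _ := by gcongr; linarith

end Privacy

/-! ### Reports as estimators -/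

lemma abs_sgn (b : Bool) : |sgn b| = 1 := by cases b <;> simp [sgn]

lemma sgn_mul_self (b : Bool) : sgn b * sgn b = 1 := by cases b <;> simp [sgn]

lemma sgn_not (b : Bool) : sgn (!b) = -sgn b := by cases b <;> simp [sgn]

/-- The inner product of `a / √m` with the vector that a report stands for. -/
def score {m : ℕ} (ε : ℝ) (a : Fin m → ℝ) (r : Fin m × Bool) : ℝ := cEps ε * a r.1 * sgn r.2

lemma cEps_nonneg {ε : ℝ} (hε : 0 ≤ ε) : 0 ≤ cEps ε :=
  div_nonneg (by positivity) (sub_nonneg.2 (Real.one_le_exp hε))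

lemma cEps_le {ε : ℝ} (hε : 0 < ε) : cEps ε ≤ 1 + 2 / ε := by
  have h := Real.add_one_le_exp ε
  have h1 : cEps ε = 1 + 2 / (Real.exp ε - 1) := by
    have : Real.exp ε - 1 ≠ 0 := by linarith
    unfold cEps
    field_simp
    ring
  rw [h1]
  gcongr
  linarith

lemma abs_score_le {m : ℕ} {ε : ℝ} (hε : 0 ≤ ε) {a : Fin m → ℝ} (ha : ∀ j, |a j| ≤ 1)
    (r : Fin m × Bool) : |score ε a r| ≤ cEps ε := by
  rw [score, abs_mul, abs_mul, abs_sgn, mul_one, abs_of_nonneg (cEps_nonneg hε)]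
  exact mul_le_of_le_one_right (cEps_nonneg hε) (ha _)

/-- The basic randomizer is unbiased. -/
lemma expect_basicRandomizer_score {m : ℕ} [NeZero m] {ε : ℝ} (hε : 0 < ε)
    (x : Option (Fin m → Bool)) (a : Fin m → ℝ) :
    expect (basicRandomizer ε x) (score ε a) =
      (∑ j, a j * x.elim 0 fun x => sgn (x j)) / m := by
  have h : Real.exp ε - 1 ≠ 0 := by linarith [Real.add_one_le_exp ε]
  have h' : Real.exp ε + 1 ≠ 0 := by positivity
  rcases x with _ | x
  · rw [expect_basicRandomizer_none]
    simp [score, sgn]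
  · rw [expect_basicRandomizer_some]
    congr 1
    refine Finset.sum_congr rfl fun j _ => ?_
    simp only [score, sgn_not, Option.elim_some, cEps]
    field_simp
    ring

lemma sum_mul_multiset_sum {ι α : Type*} [Fintype ι] (a : ι → ℝ) (f : α → ι → ℝ)
    (R : Multiset α) :
    ∑ j, a j * (R.map fun r => f r j).sum = (R.map fun r => ∑ j, a j * f r j).sum := by
  induction R using Multiset.induction_on with
  | empty => simp
  | cons r R ih => simp [mul_add, Finset.sum_add_distrib, ih]

lemma sum_mul_reportVec {m : ℕ} (ε : ℝ) (a : Fin m → ℝ) (r : Fin m × Bool) :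
    ∑ j, a j * reportVec ε r j = Real.sqrt m * score ε a r := by
  simp only [reportVec, mul_ite, mul_zero, Finset.sum_ite_eq', Finset.mem_univ, if_true, score]
  ring

/-- The `√m` in a report cancels the `1/√m` in a column, so the estimate is an average of numbers
whose size does not depend on `m`. With no reports both sides are `0`. -/
lemma foEstimate_eq {d m : ℕ} [NeZero m] (ε : ℝ) (Φ : Fin d → Fin m → Bool)
    (R : Multiset (Fin m × Bool)) (v : Fin d) :
    foEstimate ε Φ R v = (R.map (score ε fun j => sgn (Φ v j))).sum / Multiset.card R := by
  have hm : Real.sqrt m ≠ 0 := by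
    have := NeZero.ne m
    positivity
  simp only [foEstimate, average, ← mul_div_assoc, ← Finset.sum_div]
  rw [sum_mul_multiset_sum]
  congr 3
  funext r
  rw [sum_mul_reportVec]
  simp only [score, vertex]
  field_simp

/-- If decoding fails, the reports are not correlated with the codeword on the set of the wrong
coordinates. -/
lemma ppDecode_eq {d : ℕ} {ζ : ℝ} (code : BinaryCode d ζ) (ε : ℝ)
    (R : Multiset (Fin code.m × Bool)) (v : Fin d)
    (h : ∀ J : Finset (Fin code.m), code.m * ζ / 2 ≤ J.card →
      0 < (R.map (score ε fun j => if j ∈ J then sgn (code.enc v j) else 0)).sum) :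
    ppDecode code ε R = v := by
  refine code.dec_eq v _ ?_
  by_contra! hd
  set J : Finset (Fin code.m) :=
    Finset.univ.filter fun j => decide (0 ≤ average ε R j) ≠ code.enc v j with hJ
  have hpos := h J (hd.trans_eq rfl)
  have hsq : 0 < Real.sqrt code.m := Real.sqrt_pos.2 (Nat.cast_pos.2 code.m_pos)
  refine absurd (mul_pos hsq hpos) (not_lt.2 ?_)
  have key := sum_mul_multiset_sum (fun j => if j ∈ J then sgn (code.enc v j) else 0)
    (reportVec ε) R
  simp only [sum_mul_reportVec, Multiset.sum_map_mul_left] at key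
  rw [← key]
  -- At a wrong coordinate the codeword sign is opposite to the rounded sign of the average, so no
  -- term is positive; an average of exactly `0`, which rounds to `+`, contributes `0`.
  refine Finset.sum_nonpos fun j _ => ?_
  by_cases hj : j ∈ J
  · rw [if_pos hj]
    rw [hJ, Finset.mem_filter] at hj
    have hc : (0 : ℝ) ≤ Multiset.card R := Nat.cast_nonneg _
    have hav : (R.map fun r => reportVec ε r j).sum = average ε R j * Multiset.card R := by
      rcases eq_or_ne (Multiset.card R) 0 with h0 | h0
      · simp [Multiset.card_eq_zero.1 h0]
      · rw [average, div_mul_cancel₀ _ (Nat.cast_ne_zero.2 h0)]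
    rw [hav]
    rcases le_or_gt 0 (average ε R j) with h0 | h0
    · have : code.enc v j = false := by simpa [h0] using hj.2
      rw [this]
      have := mul_nonneg h0 hc
      simpa [sgn] using this
    · have : code.enc v j = true := by simpa [not_le.2 h0] using hj.2
      rw [this]
      have := mul_nonneg (neg_nonneg.2 h0.le) hc
      simpa [sgn] using this
  · simp [hj]

/-! ### The accepted reports -/

lemma sum_map_collected {n : ℕ} {Report : Type*} (y : Fin n → Report) (b : Fin n → Bool)
    (g : Report → ℝ) :
    ((LocalProtocol.collected y b).map g).sum = ∑ i, if b i = true then g (y i) else 0 := by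
  rw [LocalProtocol.collected, Multiset.map_map, ← Finset.sum_filter]
  rfl

lemma card_collected {n : ℕ} {Report : Type*} (y : Fin n → Report) (b : Fin n → Bool) :
    (Multiset.card (LocalProtocol.collected y b) : ℝ) = ∑ i, if b i = true then 1 else 0 := by
  rw [LocalProtocol.collected, Multiset.card_map, ← Finset.sum_filter]
  simp
  rfl

/-- The joint law of the public string and of the bit of a user. -/
def LocalProtocol.userLaw {n : ℕ} {V Coins Report Out : Type*}
    (P : LocalProtocol n V Coins Report Out) (c : Coins) (i : Fin n) (v : Option V) :
    PMF (Report × Bool) :=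
  (P.randomizer c i none).bind fun y => (P.oneBitRandomizer c i y v).map (y, ·)

/-- Regrouping strings and bits by user exposes, for fixed coins, a single independent family
indexed by the users, as Hoeffding's inequality requires. -/
lemma LocalProtocol.oneBitOutput_eq {n : ℕ} {V Coins Report Out : Type*} [Fintype Report]
    (P : LocalProtocol n V Coins Report Out) (v : Fin n → Option V) :
    P.oneBitOutput v = P.coins.bind fun c => (indep fun i => P.userLaw c i (v i)).map fun ω =>
      P.server c (collected (fun i => (ω i).1) (fun i => (ω i).2)) := by
  unfold oneBitOutput userLaw
  congr 1
  funext c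
  exact indep_bind_indep (fun i => P.randomizer c i none)
    (fun i y => P.oneBitRandomizer c i y (v i)) fun y b => P.server c (collected y b)

/-! ### Frequency estimation and decoding for fixed public coins -/

section Protocol

variable {S : Type*} [Fintype S] [Nonempty S] {n d K : ℕ} {ζ ε β : ℝ}
  (code : BinaryCode d ζ) (H : PairwiseIndepHash S d K)

/-- A user accepts with probability `1/2`, and its public string is then distributed like its
report in the original protocol. -/
lemma expect_userLaw (hε : 0 < ε) (hε2 : ε ≤ Real.log 2) (hβ : 0 < β) (hβ1 : β < 1)
    (c) (i : Fin n) (v : Option (Fin d))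
    (g : SHReport (rounds β) K code.m (shFoDim n d ε β) → ℝ) :
    expect ((protSH n ε β code H).userLaw c i v) (fun r => if r.2 = true then g r.1 else 0) =
      1 / 2 * expect ((protSH n ε β code H).randomizer c i v) g := by
  simp only [LocalProtocol.userLaw, expect_bind, expect_map, LocalProtocol.oneBitRandomizer,
    expect_coin (protSH_acceptProb_le_one code H hε hε2 hβ hβ1 c i v _)]
  simp only [expect, Finset.mul_sum]
  -- Pointwise, the mass of `y` under `⊥` cancels the denominator of the acceptance probability and
  -- leaves half the mass under `v`.
  refine Finset.sum_congr rfl fun y _ => ?_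
  have h0 := (protSH_randomizer_none_pos (ε := ε) (β := β) code H c i y).ne'
  rw [protSH_acceptProb_toReal]
  simp only [if_true, Bool.false_eq_true, if_false]
  field_simp
  ring

lemma expect_protSH_fo (c) (i : Fin n) (v : Option (Fin d))
    (g : Fin (shFoDim n d ε β) × Bool → ℝ) :
    expect ((protSH n ε β code H).randomizer c i v) (fun y => g y.2) =
      expect (basicRandomizer (channelEps ε β) (v.map c.2)) g := by
  simp only [protSH, expect_bind, expect_map, expect_const]

lemma expect_protSH_channel (c) (i : Fin n) (v : Option (Fin d)) (tk : Fin (rounds β) × Fin K)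
    (g : Fin code.m × Bool → ℝ) :
    expect ((protSH n ε β code H).randomizer c i v) (fun y => g (y.1 tk)) =
      expect (basicRandomizer (channelEps ε β)
        ((v.filter fun w => H.hash (c.1 tk.1) w = tk.2).map code.enc)) g := by
  simp only [protSH, expect_bind, expect_map, expect_const]
  exact expect_indep_apply (fun tk : Fin (rounds β) × Fin K => basicRandomizer (channelEps ε β)
    ((v.filter fun w => H.hash (c.1 tk.1) w = tk.2).map code.enc)) tk g

/-- The inner product of two columns of a sign matrix. -/
def columnCorr {m : ℕ} (Φ : Fin d → Fin m → Bool) (v w : Fin d) : ℝ :=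
  (∑ j, sgn (Φ v j) * sgn (Φ w j)) / m

lemma columnCorr_self {m : ℕ} [NeZero m] (Φ : Fin d → Fin m → Bool) (v : Fin d) :
    columnCorr Φ v v = 1 := by
  have : (m : ℝ) ≠ 0 := Nat.cast_ne_zero.2 (NeZero.ne m)
  simp [columnCorr, sgn_mul_self, this]

lemma frequency_nonneg (items : Fin n → Option (Fin d)) (v : Fin d) : 0 ≤ frequency items v := by
  unfold frequency
  positivity

lemma frequency_le_one (items : Fin n → Option (Fin d)) (v : Fin d) : frequency items v ≤ 1 := by
  unfold frequency
  refine div_le_one_of_le₀ ?_ (Nat.cast_nonneg _)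
  exact_mod_cast (Finset.card_le_univ _).trans_eq (Fintype.card_fin n)

lemma natCast_mul_frequency (items : Fin n → Option (Fin d)) (v : Fin d) :
    n * frequency items v = ∑ i, if items i = some v then (1 : ℝ) else 0 := by
  rw [frequency]
  rcases Nat.eq_zero_or_pos n with rfl | hn
  · simp
  · rw [mul_div_cancel₀ _ (by positivity)]
    simp

/-- The centred contribution of a user to the estimate of the frequency of `v`. -/
def foDeviation (c : (Fin (rounds β) → S) × (Fin d → Fin (shFoDim n d ε β) → Bool))
    (items : Fin n → Option (Fin d)) (v : Fin d)
    (r : SHReport (rounds β) K code.m (shFoDim n d ε β) × Bool) : ℝ :=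
  if r.2 = true then
    score (channelEps ε β) (fun j => sgn (c.2 v j)) r.1.2 - frequency items v else 0

lemma channelEps_pos (hε : 0 < ε) : 0 < channelEps ε β := by
  unfold channelEps
  positivity

/-- If the columns of the sign matrix are almost orthogonal, the centred contributions almost
have mean zero. -/
lemma abs_sum_expect_foDeviation_le (hε : 0 < ε) (hε2 : ε ≤ Real.log 2) (hβ : 0 < β)
    (hβ1 : β < 1) (c) (items : Fin n → Option (Fin d)) (v : Fin d) {σ : ℝ} (hσ0 : 0 ≤ σ)
    (hσ : ∀ w, v ≠ w → |columnCorr c.2 v w| ≤ σ) :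
    |∑ i, expect ((protSH n ε β code H).userLaw c i (items i))
      (foDeviation code (S := S) (K := K) c items v)| ≤ n * σ / 2 := by
  have hE : ∀ i, expect ((protSH n ε β code H).userLaw c i (items i))
      (foDeviation code (S := S) (K := K) c items v) =
      1 / 2 * ((items i).elim 0 (columnCorr c.2 v) - frequency items v) := by
    intro i
    unfold foDeviation
    rw [expect_userLaw code H hε hε2 hβ hβ1 c i (items i) fun y =>
      score (channelEps ε β) (fun j => sgn (c.2 v j)) y.2 - frequency items v, expect_sub,
      expect_const, expect_protSH_fo code H c i _ (score (channelEps ε β) fun j => sgn (c.2 v j)),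
      expect_basicRandomizer_score (channelEps_pos hε)]
    cases items i <;> simp [columnCorr]
  -- Since `n f(v)` counts the users holding `v`, the centring constants can be redistributed to
  -- these users. Their terms then vanish exactly, and any other user contributes at most `σ/2`.
  have hsum : ∑ i, expect ((protSH n ε β code H).userLaw c i (items i))
      (foDeviation code (S := S) (K := K) c items v) =
      ∑ i, 1 / 2 * ((items i).elim 0 (columnCorr c.2 v) -
        if items i = some v then (1 : ℝ) else 0) := by
    simp only [hE]
    rw [← Finset.mul_sum, ← Finset.mul_sum, Finset.sum_sub_distrib, Finset.sum_sub_distrib,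
      ← natCast_mul_frequency]
    simp
  rw [hsum]
  calc |∑ i, 1 / 2 * ((items i).elim 0 (columnCorr c.2 v) -
        if items i = some v then (1 : ℝ) else 0)|
      ≤ ∑ i, |1 / 2 * ((items i).elim 0 (columnCorr c.2 v) -
        if items i = some v then (1 : ℝ) else 0)| := Finset.abs_sum_le_sum_abs _ _
    _ ≤ ∑ _i : Fin n, σ / 2 := by
        refine Finset.sum_le_sum fun i _ => ?_
        rw [abs_mul, abs_of_pos (by norm_num : (0 : ℝ) < 1 / 2)]
        rcases items i with _ | w
        · simpa using div_nonneg hσ0 two_pos.le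
        · by_cases hw : v = w
          · subst hw
            simpa [columnCorr_self] using div_nonneg hσ0 two_pos.le
          · have := hσ w hw
            simp [Ne.symm hw]
            linarith
    _ = n * σ / 2 := by simp; ring

/-- The raw frequency estimates computed by the server from the pairs of strings and bits. -/
def rawEstimate (c : (Fin (rounds β) → S) × (Fin d → Fin (shFoDim n d ε β) → Bool))
    (ω : Fin n → SHReport (rounds β) K code.m (shFoDim n d ε β) × Bool) : Fin d → ℝ :=
  foEstimate (channelEps ε β) c.2
    ((LocalProtocol.collected (fun i => (ω i).1) fun i => (ω i).2).map fun r => r.2)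

/-- The number of users whose bit is `1`. -/
def acceptedCount {Report : Type*} (ω : Fin n → Report × Bool) : ℝ :=
  ∑ i, if (ω i).2 = true then 1 else 0

lemma acceptedCount_nonneg {Report : Type*} (ω : Fin n → Report × Bool) : 0 ≤ acceptedCount ω :=
  Finset.sum_nonneg fun i _ => by split_ifs <;> norm_num

lemma rawEstimate_eq (c : (Fin (rounds β) → S) × (Fin d → Fin (shFoDim n d ε β) → Bool)) (ω)
    (v : Fin d) :
    rawEstimate code (K := K) c ω v =
      (∑ i, if (ω i).2 = true then
        score (channelEps ε β) (fun j => sgn (c.2 v j)) (ω i).1.2 else 0) / acceptedCount ω := by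
  rw [rawEstimate, foEstimate_eq, Multiset.map_map, Multiset.card_map, card_collected,
    sum_map_collected]
  rfl

/-- Clearing the random denominator turns the error of a ratio into a sum of independent terms, so
the number of accepted reports only has to be bounded below. -/
lemma acceptedCount_mul_rawEstimate_sub
    (c : (Fin (rounds β) → S) × (Fin d → Fin (shFoDim n d ε β) → Bool)) (ω)
    (items : Fin n → Option (Fin d)) (v : Fin d) (hN : 0 < acceptedCount ω) :
    acceptedCount ω * (rawEstimate code (K := K) c ω v - frequency items v) =
      ∑ i, foDeviation code c items v (ω i) := by
  rw [rawEstimate_eq, mul_sub, mul_div_cancel₀ _ hN.ne', acceptedCount, Finset.sum_mul,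
    ← Finset.sum_sub_distrib]
  refine Finset.sum_congr rfl fun i _ => ?_
  unfold foDeviation
  split_ifs <;> simp

/-- The trivial bound, which already suffices when `n` is small compared with `log(1/β)`. -/
lemma abs_rawEstimate_le (hε : 0 < ε)
    (c : (Fin (rounds β) → S) × (Fin d → Fin (shFoDim n d ε β) → Bool)) (ω) (v : Fin d) :
    |rawEstimate code (K := K) c ω v| ≤ cEps (channelEps ε β) := by
  have hc := cEps_nonneg (channelEps_nonneg (β := β) hε.le)
  rw [rawEstimate_eq, abs_div, abs_of_nonneg (acceptedCount_nonneg ω)]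
  refine div_le_of_le_mul₀ (acceptedCount_nonneg ω) hc ?_
  rw [acceptedCount, Finset.mul_sum]
  refine (Finset.abs_sum_le_sum_abs _ _).trans (Finset.sum_le_sum fun i _ => ?_)
  split_ifs
  · rw [mul_one]
    exact abs_score_le (channelEps_nonneg hε.le) (fun j => (abs_sgn _).le) _
  · simp

/-- Each bit is fair whatever the item, so the event is a downward deviation of `n/4` from the mean
`n/2`. -/
lemma acceptedCount_tail (hε : 0 < ε) (hε2 : ε ≤ Real.log 2) (hβ : 0 < β) (hβ1 : β < 1) (c)
    (items : Fin n → Option (Fin d)) :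
    (indep fun i => (protSH n ε β code H).userLaw c i (items i)).toOuterMeasure
      {ω | acceptedCount ω ≤ n / 4} ≤ ENNReal.ofReal (Real.exp (-(n / 128))) := by
  have h := indep_lower_tail (fun i => (protSH n ε β code H).userLaw c i (items i))
    (fun _ r => if r.2 = true then (1 : ℝ) else 0) one_pos (s := n / 4) (by positivity)
    (fun i r => by split_ifs <;> simp)
  have hE : ∀ i, expect ((protSH n ε β code H).userLaw c i (items i))
      (fun r => if r.2 = true then (1 : ℝ) else 0) = 1 / 2 := fun i => by
    rw [expect_userLaw code H hε hε2 hβ hβ1 c i (items i) fun _ => 1, expect_const, mul_one]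
  simp only [hE, Finset.sum_const, Finset.card_univ, Fintype.card_fin, nsmul_eq_mul] at h
  convert h using 4
  · rw [acceptedCount]
    constructor <;> intro h' <;> linarith
  · rcases Nat.eq_zero_or_pos n with rfl | hn
    · simp
    · field_simp
      norm_num

/-- The frequency oracle is accurate on all items. -/
lemma rawEstimate_accurate (hn : 1 ≤ n) (hε : 0 < ε) (hε2 : ε ≤ Real.log 2) (hβ : 0 < β)
    (hβ1 : β < 1) (c)
    (items : Fin n → Option (Fin d)) {σ a s e₁ : ℝ} (hσ0 : 0 ≤ σ) (hs : 0 ≤ s)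
    (hσ : ∀ v w, v ≠ w → |columnCorr c.2 v w| ≤ σ) (ha : cEps (channelEps ε β) + 1 ≤ a)
    (hnum : a ≤ e₁ ∨ Real.exp (-(n / 128)) ≤ β / 6 ∧
      d * (2 * Real.exp (-(s ^ 2 / (8 * n * a ^ 2)))) ≤ β / 6 ∧ 4 * s / n + 2 * σ ≤ e₁) :
    (indep fun i => (protSH n ε β code H).userLaw c i (items i)).toOuterMeasure
      {ω | ∃ v, e₁ < |rawEstimate code c ω v - frequency items v|} ≤
        ENNReal.ofReal (β / 3) := by
  have hc := cEps_nonneg (channelEps_nonneg (β := β) hε.le)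
  have ha0 : 0 < a := by linarith
  have hf : ∀ v, |frequency items v| ≤ 1 := fun v => by
    rw [abs_of_nonneg (frequency_nonneg items v)]
    exact frequency_le_one items v
  -- In the first case the error bound exceeds the largest possible error and the event is empty.
  rcases hnum with h | ⟨h1, h2, h3⟩
  · have : {ω | ∃ v, e₁ < |rawEstimate code c ω v - frequency items v|} =
        (∅ : Set (Fin n → SHReport (rounds β) K code.m (shFoDim n d ε β) × Bool)) := by
      ext ω
      simp only [Set.mem_ofPred_eq, Set.mem_empty_iff_false, iff_false, not_exists, not_lt]
      intro v
      have h1 := abs_sub (rawEstimate code c ω v) (frequency items v)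
      have h2 := abs_rawEstimate_le code hε c ω v
      linarith [hf v]
    rw [this]
    simp
  · set μ := indep fun i => (protSH n ε β code H).userLaw c i (items i)
    set X := fun v => foDeviation code (S := S) (K := K) c items v
    set A : Fin d → Set (Fin n → SHReport (rounds β) K code.m (shFoDim n d ε β) × Bool) :=
      fun v => {ω | s ≤ |∑ i, X v (ω i) -
        ∑ i, expect ((protSH n ε β code H).userLaw c i (items i)) (X v)|}
    have hA : ∀ v, μ.toOuterMeasure (A v) ≤
        ENNReal.ofReal (2 * Real.exp (-(s ^ 2 / (8 * n * a ^ 2)))) := fun v => by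
      have := indep_two_tails (fun i => (protSH n ε β code H).userLaw c i (items i))
        (fun _ => X v) ha0 hs fun _ r => by
          simp only [X, foDeviation]
          split_ifs
          · refine (abs_sub _ _).trans ?_
            have := abs_score_le (channelEps_nonneg (β := β) hε.le)
              (a := fun j => sgn (c.2 v j)) (fun j => (abs_sgn _).le) r.1.2
            linarith [hf v]
          · simpa using ha0.le
      rwa [Fintype.card_fin] at this
    have hunion := toOuterMeasure_iUnion_le μ A hA
    rw [Fintype.card_fin] at hunion
    calc _ ≤ μ.toOuterMeasure ({ω | acceptedCount ω ≤ n / 4} ∪ ⋃ v, A v) := by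
          refine MeasureTheory.measure_mono fun ω hω => ?_
          obtain ⟨v, hv⟩ := hω
          by_contra hcon
          simp only [Set.mem_union, Set.mem_iUnion, not_or, not_exists, A, Set.mem_ofPred_eq,
            not_le] at hcon
          obtain ⟨hN, hdev⟩ := hcon
          have hn0 : (0 : ℝ) < n := by exact_mod_cast hn
          have hN0 : 0 < acceptedCount ω := by linarith [div_pos hn0 four_pos]
          have hmean := abs_sum_expect_foDeviation_le code H hε hε2 hβ hβ1 c items v hσ0 (hσ v)
          have hd := hdev v
          have heq := acceptedCount_mul_rawEstimate_sub code c ω items v hN0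
          have htri : |∑ i, X v (ω i)| ≤ s + n * σ / 2 := by
            have := abs_sub_abs_le_abs_sub (∑ i, X v (ω i))
              (∑ i, expect ((protSH n ε β code H).userLaw c i (items i)) (X v))
            linarith
          rw [← heq, abs_mul, abs_of_pos hN0] at htri
          -- More than `n/4` accepted reports, random deviation below `s` and bias at most `nσ/2`:
          -- hence the requirement `4s/n + 2σ ≤ e₁`.
          have h4 : n / 4 * e₁ < s + n * σ / 2 := by
            calc n / 4 * e₁ < n / 4 * |rawEstimate code c ω v - frequency items v| := by gcongr
              _ ≤ acceptedCount ω * |rawEstimate code c ω v - frequency items v| := by gcongr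
              _ ≤ _ := htri
          have h5 : n / 4 * (4 * s / n + 2 * σ) = s + n * σ / 2 := by field_simp; ring
          have h6 : (n : ℝ) / 4 * (4 * s / n + 2 * σ) ≤ n / 4 * e₁ := by gcongr
          linarith
      _ ≤ ENNReal.ofReal (β / 6) + ENNReal.ofReal (β / 6) := by
          refine (MeasureTheory.measure_union_le _ _).trans (add_le_add ?_ ?_)
          · exact (acceptedCount_tail code H hε hε2 hβ hβ1 c items).trans
              (ENNReal.ofReal_le_ofReal h1)
          · exact hunion.trans (ENNReal.ofReal_le_ofReal h2)
      _ = ENNReal.ofReal (β / 3) := by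
          rw [← ENNReal.ofReal_add (by positivity) (by positivity)]
          congr 1
          ring

/-- The item decoded by the server in a channel. -/
def decodedItem (ω : Fin n → SHReport (rounds β) K code.m (shFoDim n d ε β) × Bool)
    (tk : Fin (rounds β) × Fin K) : Fin d :=
  ppDecode code (channelEps ε β)
    ((LocalProtocol.collected (fun i => (ω i).1) fun i => (ω i).2).map fun r => r.1 tk)

/-- In a collision-free round every heavy item is decoded in its channel. -/
lemma decodedItem_eq_of_heavy (hn : 1 ≤ n) (hζ : 0 < ζ) (hε : 0 < ε) (hε2 : ε ≤ Real.log 2)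
    (hβ : 0 < β)
    (hβ1 : β < 1) (c) (items : Fin n → Option (Fin d)) {a e : ℝ} (he : 0 ≤ e)
    (ha : cEps (channelEps ε β) + 1 ≤ a) (t : Fin (rounds β))
    (hround : ∀ v, e ≤ frequency items v → ∀ i w, items i = some w → w ≠ v →
      H.hash (c.1 t) w ≠ H.hash (c.1 t) v)
    (hnum : d * 2 ^ code.m * Real.exp (-(n * e ^ 2 * ζ ^ 2 / (128 * a ^ 2))) ≤ β / 6) :
    (indep fun i => (protSH n ε β code H).userLaw c i (items i)).toOuterMeasure
      {ω | ∃ v, e ≤ frequency items v ∧ decodedItem code ω (t, H.hash (c.1 t) v) ≠ v} ≤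
        ENNReal.ofReal (β / 6) := by
  have hc := cEps_nonneg (channelEps_nonneg (β := β) hε.le)
  have ha0 : 0 < a := by linarith
  have hm0 : (0 : ℝ) < code.m := Nat.cast_pos.2 code.m_pos
  have hn0 : (0 : ℝ) < n := by exact_mod_cast hn
  set μ := indep fun i => (protSH n ε β code H).userLaw c i (items i)
  set coeff : Fin d → Finset (Fin code.m) → Fin code.m → ℝ :=
    fun v J j => if j ∈ J then sgn (code.enc v j) else 0 with hcoeff
  set X : Fin d → Finset (Fin code.m) → SHReport (rounds β) K code.m (shFoDim n d ε β) × Bool → ℝ :=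
    fun v J r => if r.2 = true then
      score (channelEps ε β) (coeff v J) (r.1.1 (t, H.hash (c.1 t) v)) else 0 with hX
  -- A lower bound for the mean of the sum: acceptance gives `1/2`, at least `n e` users hold `v`,
  -- and `|J|/m ≥ ζ/2`. A non-positive sum is therefore a deviation of at least `s`.
  set s : ℝ := n * e * ζ / 4 with hs
  have hs0 : 0 ≤ s := by positivity
  -- The set of wrong coordinates depends on the reports, so the union bound runs over all `2^m`
  -- sets `J` for each of the `d` items.
  set A : Fin d × Finset (Fin code.m) →
      Set (Fin n → SHReport (rounds β) K code.m (shFoDim n d ε β) × Bool) :=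
    fun vJ => {ω | e ≤ frequency items vJ.1 ∧ code.m * ζ / 2 ≤ vJ.2.card ∧
      ∑ i, X vJ.1 vJ.2 (ω i) ≤ 0} with hAdef
  have hA : ∀ vJ, μ.toOuterMeasure (A vJ) ≤
      ENNReal.ofReal (Real.exp (-(n * e ^ 2 * ζ ^ 2 / (128 * a ^ 2)))) := by
    rintro ⟨v, J⟩
    by_cases hv : e ≤ frequency items v ∧ code.m * ζ / 2 ≤ J.card
    · have hE : ∀ i, expect ((protSH n ε β code H).userLaw c i (items i)) (X v J) =
          1 / 2 * ((if items i = some v then (1 : ℝ) else 0) * (J.card / code.m)) := by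
        intro i
        simp only [hX]
        rw [expect_userLaw code H hε hε2 hβ hβ1 c i (items i) fun y =>
          score (channelEps ε β) (coeff v J) (y.1 (t, H.hash (c.1 t) v)),
          expect_protSH_channel code H c i _ _ (score (channelEps ε β) (coeff v J)),
          expect_basicRandomizer_score (channelEps_pos hε)]
        congr 1
        -- Only the holders of `v` have a nonzero mean: by the absence of collisions all other users
        -- randomize the zero vector in this channel.
        rcases hi : items i with _ | w
        · simp
        · by_cases hw : w = v
          · subst hw
            simp [Option.filter, hcoeff, sgn_mul_self, ite_mul]
          · have := hround v hv.1 i w hi hw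
            simp [Option.filter, this, hw]
      have hsum : 2 * s ≤ ∑ i, expect ((protSH n ε β code H).userLaw c i (items i)) (X v J) + s := by
        simp only [hE]
        rw [← Finset.mul_sum, ← Finset.sum_mul, ← natCast_mul_frequency]
        have h1 : ζ / 2 ≤ J.card / code.m := by
          rw [le_div_iff₀ hm0]; linarith [hv.2]
        have h2 : n * e * (ζ / 2) ≤ n * frequency items v * (J.card / code.m) := by
          have := hv.1
          have := frequency_nonneg items v
          gcongr
        rw [hs]
        linarith
      have h := indep_lower_tail (fun i => (protSH n ε β code H).userLaw c i (items i))
        (fun _ => X v J) ha0 hs0 fun _ r => by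
          simp only [hX]
          split_ifs
          · refine (abs_score_le (channelEps_nonneg hε.le) (fun j => ?_) _).trans
              (by linarith : cEps (channelEps ε β) ≤ a)
            simp only [hcoeff]
            split_ifs
            · exact (abs_sgn _).le
            · simp
          · simpa using ha0.le
      rw [Fintype.card_fin] at h
      refine le_trans (MeasureTheory.measure_mono ?_) (h.trans_eq ?_)
      · rintro ω ⟨-, -, hω⟩
        rw [Set.mem_ofPred_eq]
        linarith
      · congr 3
        rw [hs]
        field_simp
        ring
    · have : A (v, J) = ∅ := by
        ext ω
        simp only [hAdef, Set.mem_ofPred_eq, Set.mem_empty_iff_false, iff_false]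
        tauto
      rw [this]
      simp
  refine le_trans (MeasureTheory.measure_mono ?_) ((toOuterMeasure_iUnion_le μ A hA).trans
    (ENNReal.ofReal_le_ofReal ?_))
  · rintro ω ⟨v, hv, hdec⟩
    by_contra hcon
    simp only [Set.mem_iUnion, not_exists] at hcon
    refine hdec (ppDecode_eq code _ _ v fun J hJ => ?_)
    have := hcon (v, J)
    simp only [hAdef, Set.mem_ofPred_eq, not_and, not_le] at this
    rw [Multiset.map_map, sum_map_collected]
    exact this hv hJ
  · simpa [Fintype.card_prod, Fintype.card_finset] using hnum

/-- Sufficient conditions for the output of the server to be accurate. -/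
lemma isAccurate_of_estimates {f est : Fin d → ℝ} {θ e e₁ : ℝ} (cand : Finset (Fin d))
    (hθ : 0 ≤ θ) (hf : ∀ v, 0 ≤ f v) (hest : ∀ v, |est v - f v| ≤ e₁) (he : θ + e₁ ≤ e)
    (hcand : ∀ v, e ≤ f v → v ∈ cand) :
    IsAccurate f θ e ⟨cand.filter fun v => θ ≤ est v, est⟩ := by
  have hmem : ∀ v, v ∈ cand.filter (fun v => θ ≤ est v) ↔ v ∈ cand ∧ θ ≤ est v := fun v => by
    simp
  refine ⟨fun t ht => ⟨fun v hv => ?_, fun v hv => ?_⟩, fun v => ?_⟩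
  · rw [Set.mem_ofPred_eq] at hv
    have h1 := (abs_le.1 (hest v)).1
    have hl : v ∈ cand.filter (fun v => θ ≤ est v) :=
      (hmem v).2 ⟨hcand v (by linarith), by linarith⟩
    refine ⟨hl, ?_⟩
    rw [Histogram.estimate, if_pos hl]
    linarith
  · obtain ⟨hl, hv⟩ := hv
    rw [Histogram.estimate, if_pos hl] at hv
    have h1 := (abs_le.1 (hest v)).2
    rw [Set.mem_ofPred_eq]
    simp only at hv
    linarith
  · rw [Histogram.estimate]
    split_ifs with hl
    · exact (hest v).trans (by linarith)
    · rw [zero_sub, abs_neg, abs_of_nonneg (hf v)]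
      -- An unlisted item with `f v > e` would be a candidate, and its estimate would be at least `e
      -- - e₁ ≥ θ`, so pruning would have kept it.
      by_contra! hv
      refine hl ((hmem v).2 ⟨hcand v hv.le, ?_⟩)
      linarith [(abs_le.1 (hest v)).1]

end Protocol

/-! ### Uniform public coins -/

section Uniform

variable {α β ι : Type*} [Fintype α] [Nonempty α] [Fintype β] [Nonempty β]

lemma uniformOfFintype_map_equiv (e : α ≃ β) :
    (PMF.uniformOfFintype α).map e = PMF.uniformOfFintype β := by
  classical
  ext b
  rw [PMF.map_apply, tsum_eq_single (e.symm b)]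
  · simp [Fintype.card_congr e]
  · intro a ha
    rw [if_neg]
    rintro rfl
    simp at ha

lemma uniformOfFintype_prod :
    PMF.uniformOfFintype (α × β) =
      (PMF.uniformOfFintype α).bind fun a => (PMF.uniformOfFintype β).map (a, ·) := by
  ext ⟨a, b⟩
  rw [bind_map_prodMk_apply _ fun _ => PMF.uniformOfFintype β]
  simp only [PMF.uniformOfFintype_apply, Fintype.card_prod, Nat.cast_mul]
  rw [ENNReal.mul_inv] <;> simp

lemma uniformOfFintype_map_fst :
    (PMF.uniformOfFintype (α × β)).map Prod.fst = PMF.uniformOfFintype α := by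
  rw [uniformOfFintype_prod, PMF.map_bind]
  simp only [PMF.map_comp]
  exact (congrArg _ (funext fun a => PMF.map_const _ a)).trans (PMF.bind_pure _)

lemma uniformOfFintype_map_snd :
    (PMF.uniformOfFintype (α × β)).map Prod.snd = PMF.uniformOfFintype β := by
  rw [← uniformOfFintype_map_equiv (Equiv.prodComm β α), PMF.map_comp]
  exact uniformOfFintype_map_fst

lemma uniformOfFintype_pi [Fintype ι] [DecidableEq ι] :
    PMF.uniformOfFintype (ι → α) = indep fun _ : ι => PMF.uniformOfFintype α := by
  ext f
  simp [indep_apply, ENNReal.inv_pow]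

end Uniform

/-! ### Collisions of hash values -/

section Hash

variable {S : Type*} [Fintype S] [Nonempty S] {n d K : ℕ} (H : PairwiseIndepHash S d K)

/-- A collision is the disjoint union, over the `K` common values, of events of probability `1/K²`.
-/
lemma card_collision (hK : 0 < K) {v w : Fin d} (h : v ≠ w) :
    (∑ s, if H.hash s v = H.hash s w then (1 : ℝ) else 0) = Fintype.card S / K := by
  have h1 : ∀ s, (if H.hash s v = H.hash s w then (1 : ℝ) else 0) =
      ∑ j, if H.hash s v = j ∧ H.hash s w = j then (1 : ℝ) else 0 := fun s => by
    simp only [ite_and, Finset.sum_ite_eq, Finset.mem_univ, if_true]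
    exact if_congr eq_comm rfl rfl
  have hS : (0 : ℝ) < Fintype.card S := Nat.cast_pos.2 Fintype.card_pos
  have hK' : (0 : ℝ) < K := Nat.cast_pos.2 hK
  have h2 : ∀ j, (∑ s, if H.hash s v = j ∧ H.hash s w = j then (1 : ℝ) else 0) =
      Fintype.card S / (K : ℝ) ^ 2 := fun j => by
    have := H.pairwise_indep v w h j j
    rw [div_eq_iff hS.ne'] at this
    rw [Finset.sum_boole, this]
    ring
  simp only [h1]
  rw [Finset.sum_comm]
  simp only [h2, Finset.sum_const, Finset.card_univ, Fintype.card_fin, nsmul_eq_mul]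
  field_simp

lemma sum_frequency_le_one (items : Fin n → Option (Fin d)) : ∑ v, frequency items v ≤ 1 := by
  rcases Nat.eq_zero_or_pos n with rfl | hn
  · simp [frequency]
  · have hn0 : (0 : ℝ) < n := by exact_mod_cast hn
    refine le_of_mul_le_mul_left ?_ hn0
    rw [Finset.mul_sum]
    simp only [natCast_mul_frequency]
    rw [Finset.sum_comm]
    calc _ ≤ ∑ _i : Fin n, (1 : ℝ) := Finset.sum_le_sum fun i _ => by
            rcases items i with _ | w <;> simp
      _ = _ := by simp

/-- The seeds under which a heavy item collides with the item of some user. -/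
def collisionSeeds (items : Fin n → Option (Fin d)) (e : ℝ) : Set S :=
  {s | ∃ v, e ≤ frequency items v ∧ ∃ i w, items i = some w ∧ w ≠ v ∧ H.hash s w = H.hash s v}

-- Frequencies sum to at most `1`, so there are at most `1/e` heavy items. Each of them collides
-- with the item of each of the `n` users with probability at most `1/K`; the union bound does the
-- rest.
open Classical in
lemma expect_collisionSeeds_le (hK : 0 < K) (items : Fin n → Option (Fin d)) {e : ℝ}
    (he : 0 < e) :
    expect (PMF.uniformOfFintype S) (fun s => if s ∈ collisionSeeds H items e then 1 else 0) ≤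
      n / (e * K) := by
  have hS : (0 : ℝ) < Fintype.card S := Nat.cast_pos.2 Fintype.card_pos
  have hK' : (0 : ℝ) < K := Nat.cast_pos.2 hK
  set heavy : Finset (Fin d) := Finset.univ.filter fun v => e ≤ frequency items v with hheavy
  have hcard : (heavy.card : ℝ) ≤ 1 / e := by
    rw [le_div_iff₀ he]
    calc (heavy.card : ℝ) * e = ∑ _v ∈ heavy, e := by simp
      _ ≤ ∑ v ∈ heavy, frequency items v :=
          Finset.sum_le_sum fun v hv => (Finset.mem_filter.1 hv).2
      _ ≤ ∑ v, frequency items v :=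
          Finset.sum_le_univ_sum_of_nonneg fun v => frequency_nonneg items v
      _ ≤ 1 := sum_frequency_le_one items
  set coll : S → Fin d → Fin n → ℝ := fun s v i =>
    if ∃ w, items i = some w ∧ w ≠ v ∧ H.hash s w = H.hash s v then 1 else 0 with hcoll
  have hcoll0 : ∀ s v i, 0 ≤ coll s v i := fun s v i => by
    simp only [hcoll]
    split_ifs <;> norm_num
  have hpt : ∀ s, (if s ∈ collisionSeeds H items e then (1 : ℝ) else 0) ≤
      ∑ v ∈ heavy, ∑ i, coll s v i := by
    intro s
    split_ifs with hs
    · obtain ⟨v, hv, i, w, hw⟩ := hs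
      have h1 : coll s v i = 1 := if_pos ⟨w, hw⟩
      calc (1 : ℝ) = coll s v i := h1.symm
        _ ≤ ∑ i, coll s v i :=
            Finset.single_le_sum (f := coll s v) (fun i _ => hcoll0 s v i) (Finset.mem_univ i)
        _ ≤ _ := Finset.single_le_sum (f := fun v => ∑ i, coll s v i)
            (fun v _ => Finset.sum_nonneg fun i _ => hcoll0 s v i) (by simpa [hheavy] using hv)
    · exact Finset.sum_nonneg fun v _ => Finset.sum_nonneg fun i _ => hcoll0 s v i
  have hsum : ∀ v i, ∑ s, coll s v i ≤ Fintype.card S / K := by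
    intro v i
    simp only [hcoll]
    rcases hi : items i with _ | w
    · simp
      positivity
    · by_cases hw : w = v
      · simp [hw]
        positivity
      · rw [← card_collision H hK hw]
        simp [hw]
  rw [expect_uniform, div_le_iff₀ hS]
  calc ∑ s, (if s ∈ collisionSeeds H items e then (1 : ℝ) else 0)
      ≤ ∑ s, ∑ v ∈ heavy, ∑ i, coll s v i := Finset.sum_le_sum fun s _ => hpt s
    _ = ∑ v ∈ heavy, ∑ i, ∑ s, coll s v i := by
        rw [Finset.sum_comm]
        exact Finset.sum_congr rfl fun v _ => Finset.sum_comm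
    _ ≤ ∑ _v ∈ heavy, ∑ _i : Fin n, (Fintype.card S / K : ℝ) :=
        Finset.sum_le_sum fun v _ => Finset.sum_le_sum fun i _ => hsum v i
    _ = heavy.card * (n * (Fintype.card S / K)) := by simp
    _ ≤ 1 / e * (n * (Fintype.card S / K)) := by gcongr
    _ = n / (e * K) * Fintype.card S := by field_simp

end Hash

/-! ### Near-orthogonality of the columns of a random sign matrix -/

/-- Flipping the entry at `v` is a sign-reversing involution. -/
lemma expect_sgn_mul_sgn {d : ℕ} {v w : Fin d} (h : v ≠ w) :
    expect (PMF.uniformOfFintype (Fin d → Bool)) (fun col => sgn (col v) * sgn (col w)) = 0 := by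
  rw [expect_uniform, div_eq_zero_iff]
  left
  refine Finset.sum_involution (fun col _ => Function.update col v (!(col v))) ?_ ?_ ?_ ?_
  · intro col _
    simp [Function.update_of_ne h.symm, sgn_not]
  · intro col _ _ hcol
    have := congrFun hcol v
    simp at this
  · simp
  · intro col _
    simp

/-- For a fixed pair of distinct columns the correlation is an average of `m` independent centred
signs, one per row; the union bound covers the `d²` pairs. -/
lemma columnCorr_tail {d m : ℕ} [NeZero m] {σ : ℝ} (hσ : 0 ≤ σ)
    (hnum : (d : ℝ) ^ 2 * (2 * Real.exp (-(m * σ ^ 2 / 8))) ≤ b) :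
    (PMF.uniformOfFintype (Fin d → Fin m → Bool)).toOuterMeasure
      {Φ | ∃ v w, v ≠ w ∧ σ < |columnCorr Φ v w|} ≤ ENNReal.ofReal b := by
  have hm : (0 : ℝ) < m := Nat.cast_pos.2 (NeZero.pos m)
  set A : Fin d × Fin d → Set (Fin m → Fin d → Bool) := fun vw =>
    {Ψ | vw.1 ≠ vw.2 ∧ m * σ ≤ |∑ j, sgn (Ψ j vw.1) * sgn (Ψ j vw.2)|} with hAdef
  set p : Fin m → PMF (Fin d → Bool) := fun _ => PMF.uniformOfFintype (Fin d → Bool)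
  have hA : ∀ vw, (indep p).toOuterMeasure (A vw) ≤
      ENNReal.ofReal (2 * Real.exp (-(m * σ ^ 2 / 8))) := by
    rintro ⟨v, w⟩
    by_cases hvw : v = w
    · have : A (v, w) = ∅ := by
        ext Ψ
        simp [hAdef, hvw]
      rw [this]
      simp
    · have h := indep_two_tails p (fun _ col => sgn (col v) * sgn (col w)) one_pos
        (s := m * σ) (by positivity) fun _ col => by simp [abs_mul, abs_sgn]
      simp only [p, expect_sgn_mul_sgn hvw, Finset.sum_const_zero, sub_zero, Fintype.card_fin] at h
      refine le_trans (MeasureTheory.measure_mono fun Ψ hΨ => hΨ.2) (h.trans_eq ?_)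
      congr 4
      field_simp
  -- Transposing makes the uniform matrix an independent family of rows.
  rw [← uniformOfFintype_map_equiv (Equiv.piComm fun (_ : Fin m) (_ : Fin d) => Bool),
    PMF.toOuterMeasure_map_apply, uniformOfFintype_pi]
  refine le_trans (MeasureTheory.measure_mono ?_) ((toOuterMeasure_iUnion_le _ A hA).trans
    (ENNReal.ofReal_le_ofReal ?_))
  · rintro Ψ ⟨v, w, hvw, h⟩
    refine Set.mem_iUnion.2 ⟨(v, w), hvw, ?_⟩
    rw [columnCorr, abs_div, abs_of_pos hm, lt_div_iff₀ hm] at h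
    rw [mul_comm]
    exact h.le
  · rw [Fintype.card_prod, Fintype.card_fin, Nat.cast_mul, ← sq]
    exact hnum

/-! ### Accuracy, in terms of numerical conditions on the parameters -/

/-- Separates probability from arithmetic: the coins fail with probability at most `β/3 + β/6`, and
for good coins the users' randomness fails with at most the same amount. -/
theorem protSH_oneBitOutput_accurate {S : Type*} [Fintype S] [Nonempty S] {n d K : ℕ} {ζ ε β : ℝ}
    (code : BinaryCode d ζ) (H : PairwiseIndepHash S d K) (hn : 1 ≤ n) (hK : 0 < K) (hζ : 0 < ζ)
    (hε : 0 < ε) (hε2 : ε ≤ Real.log 2) (hβ : 0 < β) (hβ1 : β < 1)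
    (items : Fin n → Option (Fin d)) {σ a s e₁ e : ℝ} (hσ0 : 0 ≤ σ) (hs : 0 ≤ s) (he0 : 0 < e)
    (ha : cEps (channelEps ε β) + 1 ≤ a) (he : threshold n d ε β + e₁ ≤ e)
    (hseed : n / (e * K) ≤ Real.exp (-1))
    (hcorr : (d : ℝ) ^ 2 * (2 * Real.exp (-(shFoDim n d ε β * σ ^ 2 / 8))) ≤ β / 6)
    (hfo : a ≤ e₁ ∨ Real.exp (-(n / 128)) ≤ β / 6 ∧
      d * (2 * Real.exp (-(s ^ 2 / (8 * n * a ^ 2)))) ≤ β / 6 ∧ 4 * s / n + 2 * σ ≤ e₁)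
    (hdec : d * 2 ^ code.m * Real.exp (-(n * e ^ 2 * ζ ^ 2 / (128 * a ^ 2))) ≤ β / 6) :
    ENNReal.ofReal (1 - β) ≤ ((protSH n ε β code H).oneBitOutput items).toOuterMeasure
      {h | IsAccurate (frequency items) (threshold n d ε β) e h} := by
  classical
  refine ofReal_one_sub_le_of_compl _ _ hβ.le ?_
  rw [LocalProtocol.oneBitOutput_eq]
  set bad₁ : Set (Fin (rounds β) → S) := {seeds | ∀ t, seeds t ∈ collisionSeeds H items e}
  set bad₂ : Set (Fin d → Fin (shFoDim n d ε β) → Bool) :=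
    {Φ | ∃ v w, v ≠ w ∧ σ < |columnCorr Φ v w|}
  have h₁ : (protSH n ε β code H).coins.toOuterMeasure (Prod.fst ⁻¹' bad₁) ≤
      ENNReal.ofReal (β / 3) := by
    rw [← PMF.toOuterMeasure_map_apply]
    simp only [protSH]
    rw [uniformOfFintype_map_fst, uniformOfFintype_pi]
    -- Each round is bad with probability at most `1/e`, independently, and `e^(-T) ≤ β/3` by the
    -- choice of `T`.
    refine (indep_toOuterMeasure_forall_le _ _ (b := Real.exp (-1)) fun _ =>
      (expect_collisionSeeds_le H hK items he0).trans hseed).trans (ENNReal.ofReal_le_ofReal ?_)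
    rw [Fintype.card_fin, ← Real.exp_nat_mul]
    calc Real.exp (rounds β * -1) ≤ Real.exp (-Real.log (3 / β)) := by
          rw [Real.exp_le_exp]
          have : Real.log (3 / β) ≤ rounds β := Nat.le_ceil _
          linarith
      _ = β / 3 := by rw [Real.exp_neg, Real.exp_log (by positivity), inv_div]
  have h₂ : (protSH n ε β code H).coins.toOuterMeasure (Prod.snd ⁻¹' bad₂) ≤
      ENNReal.ofReal (β / 6) := by
    rw [← PMF.toOuterMeasure_map_apply]
    simp only [protSH]
    rw [uniformOfFintype_map_snd]
    exact columnCorr_tail hσ0 hcorr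
  have hsplit : ENNReal.ofReal β = ENNReal.ofReal (β / 3) + ENNReal.ofReal (β / 6) +
      (ENNReal.ofReal (β / 3) + ENNReal.ofReal (β / 6)) := by
    rw [← ENNReal.ofReal_add (by positivity) (by positivity),
      ← ENNReal.ofReal_add (by positivity) (by positivity)]
    congr 1
    ring
  rw [hsplit]
  refine (toOuterMeasure_bind_le _ _ (Prod.fst ⁻¹' bad₁ ∪ Prod.snd ⁻¹' bad₂) _
    (ENNReal.ofReal (β / 3) + ENNReal.ofReal (β / 6)) fun c hc => ?_).trans
    (add_le_add ((MeasureTheory.measure_union_le _ _).trans (add_le_add h₁ h₂)) le_rfl)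
  simp only [Set.mem_union, Set.mem_preimage, not_or] at hc
  obtain ⟨hc₁, hc₂⟩ := hc
  -- One round serves all heavy items at once, and it is determined by the seeds before any report
  -- is drawn.
  obtain ⟨t, ht⟩ : ∃ t, c.1 t ∉ collisionSeeds H items e := by
    simpa [bad₁] using hc₁
  have hround : ∀ v, e ≤ frequency items v → ∀ i w, items i = some w → w ≠ v →
      H.hash (c.1 t) w ≠ H.hash (c.1 t) v :=
    fun v hv i w hi hw heq => ht ⟨v, hv, i, w, hi, hw, heq⟩
  have hσ : ∀ v w, v ≠ w → |columnCorr c.2 v w| ≤ σ := fun v w hvw =>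
    not_lt.1 fun h => hc₂ ⟨v, w, hvw, h⟩
  rw [PMF.toOuterMeasure_map_apply]
  refine le_trans (MeasureTheory.measure_mono ?_) ((MeasureTheory.measure_union_le _ _).trans
    (add_le_add (rawEstimate_accurate code H hn hε hε2 hβ hβ1 c items hσ0 hs hσ ha hfo)
      (decodedItem_eq_of_heavy code H hn hζ hε hε2 hβ hβ1 c items he0.le ha t hround hdec)))
  intro ω hω
  by_contra hcon
  simp only [Set.mem_union, Set.mem_ofPred_eq, not_or, not_exists, not_lt, not_and, not_not]
    at hcon
  refine hω (isAccurate_of_estimates _ ?_ (frequency_nonneg items) hcon.1 he fun v hv => ?_)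
  · unfold threshold
    positivity
  · exact Finset.mem_image.2 ⟨(t, H.hash (c.1 t) v), Finset.mem_univ _, hcon.2 v hv⟩

/-! ### Numerical estimates -/

section Numerics

variable {n d : ℕ} {ε β β₀ : ℝ}

lemma log_one_div_le_log_one_div (hβ : 0 < β) (hβ₀ : β ≤ β₀) :
    Real.log (1 / β₀) ≤ Real.log (1 / β) :=
  Real.log_le_log (by have := hβ.trans_le hβ₀; positivity) (by gcongr)

lemma log_one_div_pos (hβ₀ : 0 < β₀) (hβ₀1 : β₀ < 1) : 0 < Real.log (1 / β₀) :=
  Real.log_pos (by rw [lt_div_iff₀ hβ₀]; linarith)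

lemma log_div_eq {x : ℝ} (hx : 0 < x) (hβ : 0 < β) :
    Real.log (x / β) = Real.log x + Real.log (1 / β) := by
  rw [← Real.log_mul hx.ne' (by positivity)]
  congr 1
  ring

lemma log_le_of_le_pow {x : ℝ} (hx : 0 < x) (k : ℕ) (h : x ≤ 2.7 ^ k) : Real.log x ≤ k := by
  rw [Real.log_le_iff_le_exp hx]
  calc x ≤ 2.7 ^ k := h
    _ ≤ Real.exp 1 ^ k := by gcongr; linarith [Real.exp_one_gt_d9]
    _ = Real.exp k := by rw [← Real.exp_nat_mul, mul_one]

/-- Additive constants are absorbed into `log(1/β)`, which is bounded below by `L₀`. This is where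
keeping `β` away from `1` is needed. -/
lemma log_six_div_le (hβ : 0 < β) {L₀ : ℝ} (hL₀ : 0 < L₀) (hL : L₀ ≤ Real.log (1 / β)) :
    Real.log (6 / β) ≤ (2 + 7 / L₀) * Real.log (1 / β) := by
  have h6 := log_le_of_le_pow (x := 6) (by norm_num) 2 (by norm_num)
  have h7 : 7 ≤ 7 / L₀ * Real.log (1 / β) := by
    rw [div_mul_eq_mul_div, le_div_iff₀ hL₀]
    linarith
  rw [log_div_eq (by norm_num) hβ]
  push_cast at h6
  linarith

lemma two_mul_rounds_add_one_le (hβ : 0 < β) {L₀ : ℝ} (hL₀ : 0 < L₀)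
    (hL : L₀ ≤ Real.log (1 / β)) :
    2 * (rounds β : ℝ) + 1 ≤ (2 + 7 / L₀) * Real.log (1 / β) := by
  have h3 := log_le_of_le_pow (x := 3) (by norm_num) 2 (by norm_num)
  have h3' : 0 ≤ Real.log 3 := Real.log_nonneg (by norm_num)
  have h7 : 7 ≤ 7 / L₀ * Real.log (1 / β) := by
    rw [div_mul_eq_mul_div, le_div_iff₀ hL₀]
    linarith
  have hT : (rounds β : ℝ) < Real.log (3 / β) + 1 := by
    refine Nat.ceil_lt_add_one ?_
    rw [log_div_eq (by norm_num) hβ]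
    linarith
  rw [log_div_eq (by norm_num) hβ] at hT
  push_cast at h3
  linarith

lemma log_natCast_ge (hd : 2 ≤ d) : 0.6 ≤ Real.log d := by
  have h : (2 : ℝ) ≤ d := by exact_mod_cast hd
  have := Real.log_le_log two_pos h
  linarith [Real.log_two_gt_d9]

lemma log_twelve_mul_sq_div_le (hd : 2 ≤ d) (hβ : 0 < β) {L₀ : ℝ} (hL₀ : 0 < L₀)
    (hL : L₀ ≤ Real.log (1 / β)) :
    Real.log (12 * d ^ 2 / β) ≤ (2 + 7 / L₀) * (Real.log (1 / β) * Real.log d) := by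
  have hD := log_natCast_ge hd
  have hd0 : (0 : ℝ) < d := by positivity
  have h12 := log_le_of_le_pow (x := 12) (by norm_num) 3 (by norm_num)
  rw [log_div_eq (by positivity) hβ, Real.log_mul (by norm_num) (by positivity), Real.log_pow]
  set L := Real.log (1 / β)
  set D := Real.log d
  have h7 : 7 * D ≤ 7 / L₀ * (L * D) := by
    rw [div_mul_eq_mul_div, le_div_iff₀ hL₀]
    nlinarith
  push_cast at h12 ⊢
  nlinarith

lemma exp_neg_le_of_log_le (hd : 2 ≤ d) (hβ : 0 < β) {x : ℝ}
    (hx : Real.log (12 * d ^ 2 / β) ≤ x) :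
    (d : ℝ) ^ 2 * (2 * Real.exp (-x)) ≤ β / 6 := by
  have hd0 : (0 : ℝ) < d := by positivity
  calc (d : ℝ) ^ 2 * (2 * Real.exp (-x))
      ≤ (d : ℝ) ^ 2 * (2 * Real.exp (-Real.log (12 * d ^ 2 / β))) := by gcongr
    _ = β / 6 := by
      rw [Real.exp_neg, Real.exp_log (by positivity)]
      field_simp
      norm_num

/-- Displays the origin of the power `3/2`: the full factor `log(1/β)` is the cost of splitting `ε`
over `2T + 1` shares, and the square root comes from concentration. -/
lemma rate_eq (hL : 0 < Real.log (1 / β)) :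
    rate n d ε β =
      Real.log (1 / β) / ε * Real.sqrt (Real.log (1 / β) * Real.log d / n) := by
  rw [rate, mul_div_assoc, Real.sqrt_mul hL.le, Real.sqrt_eq_rpow (Real.log (1 / β)),
    show (3 / 2 : ℝ) = 1 + 1 / 2 by norm_num, Real.rpow_add hL, Real.rpow_one]
  ring

/-- A crude constant that bounds the logarithms of the analysis. -/
def logConst (L₀ : ℝ) : ℝ := 2 + 7 / L₀

/-- The constant of the error bound. -/
def errorConst (ζ ρ L₀ : ℝ) : ℝ :=
  (logConst L₀ + 72 * logConst L₀ ^ 3) + 3 / (L₀ * Real.sqrt (L₀ / 2)) +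
    2048 * logConst L₀ ^ 2 * (logConst L₀ + ρ / L₀) / ζ

lemma two_le_logConst {L₀ : ℝ} (hL₀ : 0 < L₀) : 2 ≤ logConst L₀ := by
  unfold logConst
  have : 0 ≤ 7 / L₀ := by positivity
  linarith

lemma threshold_le (hε : 0 < ε) (hβ : 0 < β) {L₀ : ℝ} (hL₀ : 0 < L₀)
    (hL : L₀ ≤ Real.log (1 / β)) : threshold n d ε β ≤ logConst L₀ * rate n d ε β := by
  have hT := two_mul_rounds_add_one_le hβ hL₀ hL
  rw [rate_eq (hL₀.trans_le hL), threshold, mul_comm (Real.log d), ← mul_assoc, ← mul_div_assoc]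
  gcongr
  exact hT

lemma cEps_add_one_le (hε : 0 < ε) (hε2 : ε ≤ Real.log 2) (hβ : 0 < β) {L₀ : ℝ} (hL₀ : 0 < L₀)
    (hL : L₀ ≤ Real.log (1 / β)) :
    cEps (channelEps ε β) + 1 ≤ 4 * logConst L₀ * Real.log (1 / β) / ε := by
  have hx := channelEps_pos (β := β) hε
  have hlog2 : Real.log 2 < 0.7 := by linarith [Real.log_two_lt_d9]
  have hT0 : (0 : ℝ) ≤ rounds β := Nat.cast_nonneg _
  have hx1 : channelEps ε β ≤ 1 := by
    unfold channelEps
    rw [div_le_one (by positivity)]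
    linarith
  calc cEps (channelEps ε β) + 1 ≤ 1 + 2 / channelEps ε β + 1 := by
        gcongr
        exact cEps_le hx
    _ ≤ 4 / channelEps ε β := by
        have : 1 ≤ 1 / channelEps ε β := by rwa [one_le_div hx]
        have h2 : 2 / channelEps ε β = 2 * (1 / channelEps ε β) := by ring
        have h4 : 4 / channelEps ε β = 4 * (1 / channelEps ε β) := by ring
        linarith
    _ = 4 * (2 * rounds β + 1) / ε := by
        unfold channelEps
        field_simp
    _ ≤ _ := by
        rw [mul_assoc 4]
        gcongr
        exact two_mul_rounds_add_one_le hβ hL₀ hL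

lemma foGamma_pos (hn : 1 ≤ n) (hd : 2 ≤ d) (hε : 0 < ε) (hβ : 0 < β) (hβ1 : β < 1) :
    0 < foGamma n d (channelEps ε β) (β / 3) := by
  have hx := channelEps_pos (β := β) hε
  have hn0 : (0 : ℝ) < n := by exact_mod_cast hn
  have hd1 : (2 : ℝ) ≤ d := by exact_mod_cast hd
  refine Real.sqrt_pos.2 (div_pos (Real.log_pos ?_) (by positivity))
  rw [lt_div_iff₀ (by positivity)]
  linarith

lemma foGamma_le (hn : 1 ≤ n) (hd : 2 ≤ d) (hε : 0 < ε) (hβ : 0 < β) {L₀ : ℝ} (hL₀ : 0 < L₀)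
    (hL : L₀ ≤ Real.log (1 / β)) :
    foGamma n d (channelEps ε β) (β / 3) ≤ logConst L₀ ^ 2 * rate n d ε β := by
  have hx := channelEps_pos (β := β) hε
  have hn0 : (0 : ℝ) < n := by exact_mod_cast hn
  have hd1 : (2 : ℝ) ≤ d := by exact_mod_cast hd
  have hL' : 0 < Real.log (1 / β) := hL₀.trans_le hL
  have hκ := two_le_logConst hL₀
  have hD := log_natCast_ge hd
  set q := Real.sqrt (Real.log (1 / β) * Real.log d / n) with hq
  have hq2 : q ^ 2 = Real.log (1 / β) * Real.log d / n := Real.sq_sqrt (by positivity)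
  have hq0 : 0 ≤ q := Real.sqrt_nonneg _
  have hlog : Real.log (2 * d / (β / 3)) ≤ logConst L₀ * (Real.log (1 / β) * Real.log d) := by
    refine le_trans (Real.log_le_log (by positivity) ?_) (log_twelve_mul_sq_div_le hd hβ hL₀ hL)
    rw [div_div_eq_mul_div]
    refine div_le_div_of_nonneg_right ?_ hβ.le
    nlinarith
  have h1 : foGamma n d (channelEps ε β) (β / 3) ≤ logConst L₀ * q / channelEps ε β := by
    refine Real.sqrt_le_iff.2 ⟨by positivity, ?_⟩
    rw [div_pow, mul_pow, hq2, div_le_div_iff₀ (by positivity) (by positivity)]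
    have h2 : logConst L₀ * (Real.log (1 / β) * Real.log d) ≤
        logConst L₀ ^ 2 * (Real.log (1 / β) * Real.log d) := by
      gcongr
      nlinarith
    calc Real.log (2 * d / (β / 3)) * channelEps ε β ^ 2
        ≤ logConst L₀ ^ 2 * (Real.log (1 / β) * Real.log d) * channelEps ε β ^ 2 := by
          gcongr
          exact hlog.trans h2
      _ = _ := by field_simp
  refine h1.trans ?_
  rw [rate_eq hL', ← hq]
  calc logConst L₀ * q / channelEps ε β = logConst L₀ * q * (2 * rounds β + 1) / ε := by
        unfold channelEps
        field_simp
    _ ≤ logConst L₀ * q * (logConst L₀ * Real.log (1 / β)) / ε := by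
        gcongr
        exact two_mul_rounds_add_one_le hβ hL₀ hL
    _ = _ := by ring

/-- The dimension is at least `log(1/β) log d / γ²`, and rounding up only helps. With `σ = 4κγ`,
where `κ = logConst L₀`, the exponent is at least `2κ² log(1/β) log d`. -/
lemma columnCorr_tail_bound (hn : 1 ≤ n) (hd : 2 ≤ d) (hε : 0 < ε) (hβ : 0 < β) (hβ1 : β < 1)
    {L₀ : ℝ} (hL₀ : 0 < L₀) (hL : L₀ ≤ Real.log (1 / β)) :
    (d : ℝ) ^ 2 * (2 * Real.exp (-(shFoDim n d ε β *
      (4 * logConst L₀ * foGamma n d (channelEps ε β) (β / 3)) ^ 2 / 8))) ≤ β / 6 := by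
  have hγ := foGamma_pos hn hd hε hβ hβ1
  have hκ := two_le_logConst hL₀
  have hD := log_natCast_ge hd
  have hL' : 0 < Real.log (1 / β) := hL₀.trans_le hL
  have hd0 : (0 : ℝ) < d := by positivity
  refine exp_neg_le_of_log_le hd hβ ((log_twelve_mul_sq_div_le hd hβ hL₀ hL).trans ?_)
  set γ := foGamma n d (channelEps ε β) (β / 3) with hγdef
  have hdim : Real.log (1 / β) * Real.log d / γ ^ 2 ≤ shFoDim n d ε β := by
    have h1 : Real.log (d + 1) * Real.log (2 / (β / 3)) / γ ^ 2 ≤ shFoDim n d ε β :=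
      (Nat.le_ceil _).trans (Nat.cast_le.2 (le_max_right 1 _))
    refine le_trans ?_ h1
    rw [mul_comm]
    have hlog : Real.log (1 / β) ≤ Real.log (2 / (β / 3)) := by
      refine Real.log_le_log (by positivity) ?_
      rw [div_div_eq_mul_div]
      gcongr
      norm_num
    have hlog' : Real.log d ≤ Real.log (d + 1) := Real.log_le_log hd0 (by linarith)
    have hlog0 : 0 ≤ Real.log ((d : ℝ) + 1) := by linarith
    gcongr
  change logConst L₀ * _ ≤ _
  have hLD : 0 < Real.log (1 / β) * Real.log d := by positivity
  calc logConst L₀ * (Real.log (1 / β) * Real.log d)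
      ≤ 2 * logConst L₀ ^ 2 * (Real.log (1 / β) * Real.log d) := by
        gcongr
        nlinarith
    _ = Real.log (1 / β) * Real.log d / γ ^ 2 * (4 * logConst L₀ * γ) ^ 2 / 8 := by
        field_simp
        norm_num
    _ ≤ _ := by gcongr

lemma seed_bound {K : ℕ} (hn : 1 ≤ n) (hd : 2 ≤ d) (hε : 0 < ε) (hε2 : ε ≤ Real.log 2)
    (hK : (n : ℝ) ^ (3 / 2 : ℝ) ≤ K) {L₀ C : ℝ} (hL₀ : 0 < L₀) (hL : L₀ ≤ Real.log (1 / β))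
    (hC : 3 / (L₀ * Real.sqrt (L₀ / 2)) ≤ C) :
    n / (C * rate n d ε β * K) ≤ Real.exp (-1) := by
  have hn0 : (0 : ℝ) < n := by exact_mod_cast hn
  have hL' : 0 < Real.log (1 / β) := hL₀.trans_le hL
  have hD := log_natCast_ge hd
  have hlog2 : Real.log 2 < 0.7 := by linarith [Real.log_two_lt_d9]
  have hsq : 0 < Real.sqrt (L₀ / 2) := Real.sqrt_pos.2 (by positivity)
  have hC0 : 0 < C := lt_of_lt_of_le (by positivity) hC
  have hsn : 0 < Real.sqrt n := Real.sqrt_pos.2 hn0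
  have hpow : (n : ℝ) ^ (3 / 2 : ℝ) = n * Real.sqrt n := by
    rw [Real.sqrt_eq_rpow, show (3 / 2 : ℝ) = 1 + 1 / 2 by norm_num, Real.rpow_add hn0,
      Real.rpow_one]
  rw [hpow] at hK
  have hr : rate n d ε β * (n * Real.sqrt n) =
      n * (Real.log (1 / β) / ε * Real.sqrt (Real.log (1 / β) * Real.log d)) := by
    rw [rate_eq hL', Real.sqrt_div (by positivity)]
    field_simp
  have hr0 : 0 ≤ rate n d ε β := by
    rw [rate_eq hL']
    positivity
  -- The `√n` in `K ≥ n√n` cancels the `1/√n` of the rate. The rest is bounded below through `ε ≤ 1`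
  -- and `log d ≥ 1/2`, and `3` is a round upper bound for `e`.
  have hmain : 3 * n ≤ C * rate n d ε β * K := by
    calc 3 * (n : ℝ) ≤ 3 / ε * n := by
          gcongr
          rw [le_div_iff₀ hε]
          linarith
      _ = 3 / (L₀ * Real.sqrt (L₀ / 2)) * (n * (L₀ / ε * Real.sqrt (L₀ / 2))) := by
          field_simp
      _ ≤ C * (n * (Real.log (1 / β) / ε * Real.sqrt (Real.log (1 / β) * Real.log d))) := by
          gcongr
          nlinarith
      _ = C * rate n d ε β * (n * Real.sqrt n) := by rw [mul_assoc, hr]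
      _ ≤ _ := by gcongr
  have he : Real.exp 1 ≤ 3 := by linarith [Real.exp_one_lt_d9]
  rw [div_le_iff₀ (by linarith), Real.exp_neg]
  calc (n : ℝ) = (Real.exp 1)⁻¹ * (Real.exp 1 * n) := by field_simp
    _ ≤ (Real.exp 1)⁻¹ * (3 * n) := by gcongr
    _ ≤ _ := by gcongr

lemma fo_bound (hn : 1 ≤ n) (hd : 2 ≤ d) (hε : 0 < ε) (hβ : 0 < β)
    {L₀ C : ℝ} (hL₀ : 0 < L₀) (hL : L₀ ≤ Real.log (1 / β)) (hC : 72 * logConst L₀ ^ 3 ≤ C) :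
    4 * logConst L₀ * Real.log (1 / β) / ε ≤ C * rate n d ε β ∨
    Real.exp (-(n / 128)) ≤ β / 6 ∧
      d * (2 * Real.exp (-((4 * logConst L₀ * (4 * logConst L₀ * Real.log (1 / β) / ε) * n *
        Real.sqrt (Real.log (1 / β) * Real.log d / n)) ^ 2 /
          (8 * n * (4 * logConst L₀ * Real.log (1 / β) / ε) ^ 2)))) ≤ β / 6 ∧
      4 * (4 * logConst L₀ * (4 * logConst L₀ * Real.log (1 / β) / ε) * n *
        Real.sqrt (Real.log (1 / β) * Real.log d / n)) / n +
        2 * (4 * logConst L₀ * foGamma n d (channelEps ε β) (β / 3)) ≤ C * rate n d ε β := by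
  have hn0 : (0 : ℝ) < n := by exact_mod_cast hn
  have hd1 : (2 : ℝ) ≤ d := by exact_mod_cast hd
  have hL' : 0 < Real.log (1 / β) := hL₀.trans_le hL
  have hD := log_natCast_ge hd
  have hκ := two_le_logConst hL₀
  have hγ := foGamma_le hn hd hε hβ hL₀ hL
  rw [rate_eq hL'] at hγ ⊢
  have hlog6 : Real.log (6 / β) ≤ logConst L₀ * Real.log (1 / β) := log_six_div_le hβ hL₀ hL
  have hlog12 : Real.log (12 * d ^ 2 / β) ≤ logConst L₀ * (Real.log (1 / β) * Real.log d) :=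
    log_twelve_mul_sq_div_le hd hβ hL₀ hL
  set κ := logConst L₀
  set L := Real.log (1 / β)
  set D := Real.log d
  set q := Real.sqrt (L * D / n) with hq
  have hq2 : q ^ 2 = L * D / n := Real.sq_sqrt (by positivity)
  have hq0 : 0 ≤ q := Real.sqrt_nonneg _
  have hLD : 0 < L * D := by positivity
  -- If `n` is too small for the number of accepted reports to concentrate, then `q` is bounded
  -- below and the target error exceeds the trivial bound.
  rcases lt_or_ge ((n : ℝ) / 128) (Real.log (6 / β)) with h | h
  · left
    have hqκ : 1 / (16 * κ) ≤ q := by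
      refine Real.le_sqrt_of_sq_le ?_
      rw [div_pow, div_le_div_iff₀ (by positivity) hn0]
      have h1 : (n : ℝ) ≤ 128 * (κ * L) := by linarith
      nlinarith [mul_pos (mul_pos (by linarith : 0 < κ) hL') (by linarith : 0 < D)]
    calc 4 * κ * L / ε = 64 * κ ^ 2 * (L / ε * (1 / (16 * κ))) := by field_simp; norm_num
      _ ≤ C * (L / ε * q) := by
        have h64 : 64 * κ ^ 2 ≤ C := by nlinarith [sq_nonneg κ]
        have hC0 : 0 ≤ C := le_trans (by positivity) h64
        gcongr
  · right
    refine ⟨?_, ?_, ?_⟩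
    · calc Real.exp (-(n / 128)) ≤ Real.exp (-Real.log (6 / β)) := by gcongr
        _ = β / 6 := by rw [Real.exp_neg, Real.exp_log (by positivity), inv_div]
    -- The deviation is `s = 4κ a n q`, chosen so that `a` cancels: `s²/(8 n a²) = 2κ² n q²`.
    · have hexp : (4 * κ * (4 * κ * L / ε) * n * q) ^ 2 / (8 * n * (4 * κ * L / ε) ^ 2) =
          2 * κ ^ 2 * (L * D) := by
        rw [mul_pow _ q, hq2]
        field_simp
        norm_num
      rw [hexp]
      refine le_trans ?_ (exp_neg_le_of_log_le hd hβ (x := 2 * κ ^ 2 * (L * D)) ?_)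
      · gcongr
        nlinarith
      · refine hlog12.trans ?_
        gcongr
        nlinarith
    · calc 4 * (4 * κ * (4 * κ * L / ε) * n * q) / n +
            2 * (4 * κ * foGamma n d (channelEps ε β) (β / 3))
          ≤ 4 * (4 * κ * (4 * κ * L / ε) * n * q) / n + 2 * (4 * κ * (κ ^ 2 * (L / ε * q))) := by
            gcongr
        -- Random error plus bias; the sum of the coefficients is at most `72 κ³`.
        _ = (64 * κ ^ 2 + 8 * κ ^ 3) * (L / ε * q) := by field_simp; ring
        _ ≤ C * (L / ε * q) := by
            gcongr
            nlinarith [sq_nonneg κ]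

/-- The bound `a`, of order `log(1/β)/ε`, cancels the same factor of the rate. The remaining
exponent, a multiple of `log(1/β) log d`, has to beat `log(d · 2^m · 6/β)`; here a code length of
order `log d` is essential. -/
lemma decoding_bound (hn : 1 ≤ n) (hd : 2 ≤ d) (hε : 0 < ε) (hβ : 0 < β) {ζ ρ : ℝ} (hζ : 0 < ζ)
    (hρ : 0 < ρ) {L₀ C : ℝ} (hL₀ : 0 < L₀) (hL : L₀ ≤ Real.log (1 / β))
    (hC : 2048 * logConst L₀ ^ 2 * (logConst L₀ + ρ / L₀) / ζ ≤ C) {m : ℕ}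
    (hm : (m : ℝ) ≤ ρ * Real.log d) :
    d * 2 ^ m * Real.exp (-(n * (C * rate n d ε β) ^ 2 * ζ ^ 2 /
      (128 * (4 * logConst L₀ * Real.log (1 / β) / ε) ^ 2))) ≤ β / 6 := by
  have hn0 : (0 : ℝ) < n := by exact_mod_cast hn
  have hd1 : (2 : ℝ) ≤ d := by exact_mod_cast hd
  have hL' : 0 < Real.log (1 / β) := hL₀.trans_le hL
  have hD := log_natCast_ge hd
  have hκ := two_le_logConst hL₀
  have hlog12 : Real.log (12 * d ^ 2 / β) ≤ logConst L₀ * (Real.log (1 / β) * Real.log d) :=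
    log_twelve_mul_sq_div_le hd hβ hL₀ hL
  rw [rate_eq hL']
  set κ := logConst L₀
  set L := Real.log (1 / β)
  set D := Real.log d
  set q := Real.sqrt (L * D / n) with hq
  have hq2 : q ^ 2 = L * D / n := Real.sq_sqrt (by positivity)
  have hLD : 0 < L * D := by positivity
  have hρL : 0 < ρ / L₀ := by positivity
  set B := 2048 * κ ^ 2 * (κ + ρ / L₀) with hB
  -- Gives `B ≤ B² ≤ (Cζ)²`, so a constant linear in `B` is enough.
  have hB1 : 1 ≤ B := by
    rw [hB]
    have h1 : 1 ≤ κ ^ 2 := by nlinarith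
    nlinarith
  rw [div_le_iff₀ hζ] at hC
  have hexp : n * (C * (L / ε * q)) ^ 2 * ζ ^ 2 / (128 * (4 * κ * L / ε) ^ 2) =
      (C * ζ) ^ 2 * (L * D) / (2048 * κ ^ 2) := by
    rw [mul_pow C, mul_pow _ q, hq2]
    field_simp
    ring
  have hexp_ge : κ * (L * D) + m ≤ (C * ζ) ^ 2 * (L * D) / (2048 * κ ^ 2) := by
    have hmρ : (m : ℝ) ≤ ρ / L₀ * (L * D) := by
      refine hm.trans ?_
      rw [div_mul_eq_mul_div, le_div_iff₀ hL₀]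
      nlinarith [mul_pos hρ (by linarith : 0 < D)]
    calc κ * (L * D) + m ≤ (κ + ρ / L₀) * (L * D) := by linarith
      _ = B * (L * D) / (2048 * κ ^ 2) := by rw [hB]; field_simp
      _ ≤ _ := by
        gcongr
        nlinarith
  rw [hexp]
  have hbase := exp_neg_le_of_log_le hd hβ hlog12
  have h2m : (2 : ℝ) ^ m * Real.exp (-m) ≤ 1 := by
    rw [Real.exp_neg, ← div_eq_mul_inv, div_le_one (Real.exp_pos _), ← mul_one (m : ℝ),
      Real.exp_nat_mul]
    gcongr
    linarith [Real.exp_one_gt_d9]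
  calc d * 2 ^ m * Real.exp (-((C * ζ) ^ 2 * (L * D) / (2048 * κ ^ 2)))
      ≤ d * 2 ^ m * Real.exp (-(κ * (L * D) + m)) := by gcongr
    _ = d * Real.exp (-(κ * (L * D))) * (2 ^ m * Real.exp (-m)) := by
        rw [neg_add, Real.exp_add]
        ring
    _ ≤ d * Real.exp (-(κ * (L * D))) := mul_le_of_le_one_right (by positivity) h2m
    _ ≤ (d : ℝ) ^ 2 * (2 * Real.exp (-(κ * (L * D)))) := by
        have := Real.exp_pos (-(κ * (L * D)))
        nlinarith [mul_pos this (by linarith : (0 : ℝ) < d)]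
    _ ≤ β / 6 := hbase

end Numerics

end SuccinctHistogram
end

open SuccinctHistogram in
theorem mainTheorem5 :
    (∀ {S : Type} [Fintype S] [Nonempty S] (n d K : ℕ) (ζ ε β : ℝ)
      (code : BinaryCode d ζ) (H : PairwiseIndepHash S d K),
      0 < ε → ε ≤ Real.log 2 → 0 < β → β < 1 →
      ∀ c i y,
        (∀ v, (protSH n ε β code H).acceptProb c i y v ≤ 1) ∧
        IsLocallyPrivate ε ((protSH n ε β code H).oneBitRandomizer c i y)) ∧
    (∀ ζ ρ β₀ : ℝ, 0 < ζ → ζ < 1 / 2 → 0 < ρ → 0 < β₀ → β₀ < 1 →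
      ∃ C : ℝ, 0 < C ∧
        ∀ {S : Type} [Fintype S] [Nonempty S] (n d K : ℕ) (ε β : ℝ)
          (code : BinaryCode d ζ) (H : PairwiseIndepHash S d K),
          1 ≤ n → 2 ≤ d → 0 < ε → ε ≤ Real.log 2 → 0 < β → β ≤ β₀ →
          (code.m : ℝ) ≤ ρ * Real.log d →
          (n : ℝ) ^ (3 / 2 : ℝ) ≤ K → (K : ℝ) < 2 * (n : ℝ) ^ (3 / 2 : ℝ) →
          threshold n d ε β ≤ C * rate n d ε β ∧
          ∀ items : Fin n → Option (Fin d),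
            ENNReal.ofReal (1 - β) ≤
              ((protSH n ε β code H).oneBitOutput items).toOuterMeasure
                {h | IsAccurate (frequency items) (threshold n d ε β)
                  (C * rate n d ε β) h}) := by
  refine ⟨fun n d K ζ ε β code H hε hε2 hβ hβ1 c i y =>
    ⟨fun v => protSH_acceptProb_le_one code H hε hε2 hβ hβ1 c i v y,
      protSH_oneBitRandomizer_isLocallyPrivate code H hε hε2 hβ hβ1 c i y⟩,
    fun ζ ρ β₀ hζ _ hρ hβ₀ hβ₀1 => ?_⟩
  have hL₀ := log_one_div_pos hβ₀ hβ₀1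
  set L₀ := Real.log (1 / β₀)
  have hκ := two_le_logConst hL₀
  have hC1 : 0 ≤ 72 * logConst L₀ ^ 3 := by positivity
  have hC2 : 0 ≤ 3 / (L₀ * Real.sqrt (L₀ / 2)) := by positivity
  have hC3 : 0 ≤ 2048 * logConst L₀ ^ 2 * (logConst L₀ + ρ / L₀) / ζ := by positivity
  have hC0 : 0 < errorConst ζ ρ L₀ := by unfold errorConst; linarith
  refine ⟨errorConst ζ ρ L₀, hC0, ?_⟩
  intro S _ _ n d K ε β code H hn hd hε hε2 hβ hββ₀ hm hK _
  have hβ1 : β < 1 := hββ₀.trans_lt hβ₀1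
  have hL : L₀ ≤ Real.log (1 / β) := log_one_div_le_log_one_div hβ hββ₀
  have hL' : 0 < Real.log (1 / β) := hL₀.trans_le hL
  have hn0 : (0 : ℝ) < n := by exact_mod_cast hn
  have hD := log_natCast_ge hd
  have hr : 0 < rate n d ε β := by
    rw [rate_eq hL']
    have : 0 < Real.sqrt (Real.log (1 / β) * Real.log d / n) := Real.sqrt_pos.2 (by positivity)
    positivity
  have hθ : threshold n d ε β ≤ logConst L₀ * rate n d ε β := threshold_le hε hβ hL₀ hL
  have hK0 : 0 < K := by
    have : (0 : ℝ) < (n : ℝ) ^ (3 / 2 : ℝ) := by positivity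
    exact_mod_cast this.trans_le hK
  refine ⟨hθ.trans ?_, fun items => ?_⟩
  · gcongr
    unfold errorConst
    linarith
  -- Of the total constant, the share `logConst L₀` pays for the threshold and the remainder is the
  -- accuracy `e₁` of the frequency oracle.
  · refine protSH_oneBitOutput_accurate code H hn hK0 hζ hε hε2 hβ hβ1 items
      (σ := 4 * logConst L₀ * foGamma n d (channelEps ε β) (β / 3))
      (a := 4 * logConst L₀ * Real.log (1 / β) / ε)
      (s := 4 * logConst L₀ * (4 * logConst L₀ * Real.log (1 / β) / ε) * n *
        Real.sqrt (Real.log (1 / β) * Real.log d / n))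
      (e₁ := (errorConst ζ ρ L₀ - logConst L₀) * rate n d ε β)
      ?_ (by positivity) (by positivity) (cEps_add_one_le hε hε2 hβ hL₀ hL) (by linarith)
      (seed_bound hn hd hε hε2 hK hL₀ hL ?_)
      (columnCorr_tail_bound hn hd hε hβ hβ1 hL₀ hL)
      (fo_bound hn hd hε hβ hL₀ hL ?_)
      (decoding_bound hn hd hε hβ hζ hρ hL₀ hL ?_ hm)
    · have := (foGamma_pos hn hd hε hβ hβ1).le
      positivity
    · unfold errorConst
      linarith
    · unfold errorConst
      linarith
    · unfold errorConst
      linarith
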